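/- **Setting.** Fix $d\ge 1$ and $K\ge 1$. Let $\theta_1,\dots,\theta_K\in\mathbb R^d$ be fixed in advance (oblivious adversary), with $\sum_{k=1}^{K-1}\|\theta_{k+1}-\theta_k\|_2\le B_K$. In round $k=1,\dots,K$ the learner observes an arbitrary (possibly random) arm set $\mathcal D_k\subseteq\mathbb R^d$, plays $a_k\in\mathcal D_k$, and receives $r_k=\langle\theta_k,a_k\rangle+\epsilon_k$ together with $\sigma_k\ge 0$. Here $|\epsilon_k|\le R$ almost surely, $\mathbb E[\epsilon_k\mid a_{1:k},\epsilon_{1:k-1}]=0$, $\mathbb E[\epsilon_k^2\mid a_{1:k},\epsilon_{1:k-1}]=\sigma_k^2$, and $\sum_{k=1}^K\sigma_k^2\le V_K$ almost surely. For all $k\le K$ and $a\in\mathcal D_k$: $\langle a,\theta_k\rangle\in[-1,1]$, $\|a\|_2\le A$, $\|\theta_k\|_2\le B$. With $a_k^*\in\arg\max_{a\in\mathcal D_k}\langle a,\theta_k\rangle$, set $\mathrm{Regret}(K)=\sum_{k=1}^K(\langle a_k^*,\theta_k\rangle-\langle a_k,\theta_k\rangle)$. **Algorithm (Restarted-WeightedOFUL$^+$).**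 Inputs: $\lambda,\alpha,\gamma>0$, $A,B,R\ge 0$, $0<\delta<1$ and an integer window $1\le w\le K$. Write $\|v\|_M=\sqrt{v^\top Mv}$, $\log^+x=\max\{\log x,0\}$ and, for $n\in\mathbb N$, $$\rho(n)=12\sqrt{d\log\Big(1+\frac{nA^2}{\alpha^2d\lambda}\Big)\log\Big(\frac{32(\log^+(\gamma^2/\alpha)+1)n^2}{\delta}\Big)}+30\log\Big(\frac{32(\log^+(\gamma^2/\alpha)+1)n^2}{\delta}\Big)\frac{R}{\gamma^2}+\sqrt\lambda B .$$ At $k=1$, and at the start of every round $k$ divisible by $w$, reset $\hat\Sigma_k=\lambda I$, $\hat b_k=0$, $\hat\theta_k=0$, $\hat\beta_k=\sqrt\lambda B$; in all other rounds $\hat\beta_k=\rho(k\bmod w)$. In round $k$ play some $a_k\in\arg\max_{a\in\mathcal D_k}\langle a,\hat\theta_k\rangle+\hat\beta_k\|a\|_{\hat\Sigma_k^{-1}}$, set $\bar\sigma_k=\max\{\sigma_k,\alpha,\gamma\|a_k\|_{\hat\Sigma_k^{-1}}^{1/2}\}$, and update $\hat\Sigma_{k+1}=\hat\Sigma_k+a_ka_k^\top/\bar\sigma_k^2$,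 $\hat b_{k+1}=\hat b_k+r_ka_k/\bar\sigma_k^2$, $\hat\theta_{k+1}=\hat\Sigma_{k+1}^{-1}\hat b_{k+1}$. **Theorem.** Let $\iota=\log\big(1+\frac{wA^2}{d\lambda\alpha^2}\big)$ and $\hat\beta=\rho(w)$. 1. With probability at least $1-\delta$, $$\mathrm{Regret}(K)\le\frac{2A^2B_Kw^{3/2}}{\alpha}\sqrt{\frac d\lambda}+4\hat\beta\sqrt{V_K+K\alpha^2}\sqrt{\frac{Kd\iota}{w}}+\frac{4d\iota K\hat\beta\gamma^2}{w}+\frac{4d\iota K}{w}.$$ 2. $\hat\beta=\tilde O(\sqrt d+R/\gamma^2+\sqrt\lambda B)$: there are absolute constants $C>0$, $m\in\mathbb N$ such that, for all admissible inputs, $\hat\beta\le C\log^m\big(2+w+A+\frac1\lambda+\frac1\alpha+\gamma+\frac1\delta\big)\cdot(\sqrt d+R/\gamma^2+\sqrt\lambda B)$. 3. Treat $A,\lambda,B,R$ as constants, with $\lambda,R>0$, and set $\gamma^2=R/\sqrt d$. Then $\mathrm{Regret}(K)=\tilde O(B_Kw^{3/2}d^{1/2}\alpha^{-1}+dK\alpha/\sqrt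 w+d\sqrt{KV_K/w}+dK/w)$: there are an absolute $m\in\mathbb N$ and a constant $C>0$ depending only on $A,\lambda,B,R$ such that, for all $d,K,w,\alpha,\delta,B_K,V_K$ and all instances as above, with probability at least $1-\delta$, $$\mathrm{Regret}(K)\le C\log^m\Big(2+K+\frac1\alpha+\frac1\delta\Big)\Big(\frac{B_Kw^{3/2}\sqrt d}{\alpha}+\frac{dK\alpha}{\sqrt w}+d\sqrt{\frac{KV_K}{w}}+\frac{dK}{w}\Big).$$ -/

import Mathlib

open MeasureTheory
open scoped Matrix

noncomputable section

namespace RestartedOFUL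

/-- The space `ℝ^d` with its Euclidean norm and inner product. -/
abbrev Vec (d : ℕ) := EuclideanSpace ℝ (Fin d)

/-- The norm `‖v‖_M = √(vᵀ M v)`. -/
def ellNorm {d : ℕ} (M : Matrix (Fin d) (Fin d) ℝ) (v : Vec d) : ℝ :=
  Real.sqrt (v.ofLp ⬝ᵥ (M *ᵥ v.ofLp))

/-- The numerical inputs of the algorithm: regularization `lam`, variance parameters `alpha` and
`gamma`, bounds `A` on the arms, `B` on the feature vectors and `R` on the noise, the failure
probability `delta`, and the restart window size `w`. -/
structure Params where
  lam : ℝ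
  alpha : ℝ
  gamma : ℝ
  A : ℝ
  B : ℝ
  R : ℝ
  delta : ℝ
  w : ℕ

/-- The ranges of the inputs. -/
structure Params.Valid (p : Params) : Prop where
  lam_pos : 0 < p.lam
  alpha_pos : 0 < p.alpha
  gamma_pos : 0 < p.gamma
  A_nonneg : 0 ≤ p.A
  B_nonneg : 0 ≤ p.B
  R_nonneg : 0 ≤ p.R
  delta_pos : 0 < p.delta
  delta_lt_one : p.delta < 1
  one_le_w : 1 ≤ p.w

/-- The confidence radius after `n` rounds since the last restart,
`12 √(d log(1 + n A² / (α² d λ)) · log(32 (log⁺(γ²/α) + 1) n² / δ))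
  + 30 log(32 (log⁺(γ²/α) + 1) n² / δ) R / γ² + √λ B`, with `log⁺ x = max (log x) 0`. -/
def radius (p : Params) (d n : ℕ) : ℝ :=
  12 * Real.sqrt (d * Real.log (1 + n * p.A ^ 2 / (p.alpha ^ 2 * d * p.lam))
      * Real.log (32 * (max (Real.log (p.gamma ^ 2 / p.alpha)) 0 + 1) * (n : ℝ) ^ 2 / p.delta))
    + 30 * Real.log (32 * (max (Real.log (p.gamma ^ 2 / p.alpha)) 0 + 1) * (n : ℝ) ^ 2 / p.delta)
      * (p.R / p.gamma ^ 2)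
    + Real.sqrt p.lam * p.B

/-- The radius `β̂_k` used at round `k`: it is `√λ B` in the first round and in the restart rounds
`k % w = 0`, and is given by the formula with `n = k % w` otherwise. -/
def betaHat (p : Params) (d k : ℕ) : ℝ :=
  if k = 1 ∨ k % p.w = 0 then Real.sqrt p.lam * p.B else radius p d (k % p.w)

/-- The uniform radius `β̂`, the formula with `n = w`. -/
def betaMax (p : Params) (d : ℕ) : ℝ := radius p d p.w

/-- `ι = log(1 + w A² / (d λ α²))`. -/
def iota (p : Params) (d : ℕ) : ℝ :=
  Real.log (1 + p.w * p.A ^ 2 / (d * p.lam * p.alpha ^ 2))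

/-- The internal state `(Σ̂, b̂)` of the algorithm. -/
structure State (d : ℕ) where
  Sig : Matrix (Fin d) (Fin d) ℝ
  b : Fin d → ℝ

/-- The state after initialization or a restart, `(λ I, 0)`. -/
def State.init (p : Params) (d : ℕ) : State d where
  Sig := p.lam • (1 : Matrix (Fin d) (Fin d) ℝ)
  b := 0

/-- The estimate `θ̂ = Σ̂⁻¹ b̂` (which is `0` right after a restart). -/
def State.thetaHat {d : ℕ} (s : State d) : Vec d := WithLp.toLp 2 (s.Sig⁻¹ *ᵥ s.b)

/-- The weight `σ̄ = max {σ, α, γ ‖a‖_{Σ̂⁻¹}^{1/2}}`. -/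
def State.sigmaBar {d : ℕ} (p : Params) (s : State d) (a : Vec d) (σ : ℝ) : ℝ :=
  max (max σ p.alpha) (p.gamma * Real.sqrt (ellNorm s.Sig⁻¹ a))

/-- The weighted regression update `Σ̂ + a aᵀ / σ̄²`, `b̂ + r a / σ̄²`. -/
def State.update {d : ℕ} (p : Params) (s : State d) (a : Vec d) (r σ : ℝ) : State d where
  Sig := s.Sig + (1 / s.sigmaBar p a σ ^ 2) • Matrix.vecMulVec a.ofLp a.ofLp
  b := s.b + (r / s.sigmaBar p a σ ^ 2) • a.ofLp

/-- The state with which round `k ≥ 1` is played (after the restart test of that round), when the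
arms, rewards and standard deviations of the rounds `1, 2, …` are `a`, `r`, `σ`.
The index `0` is not a round and its entries are never used. -/
def state (p : Params) {d : ℕ} (a : ℕ → Vec d) (r σ : ℕ → ℝ) : ℕ → State d
  | 0 => State.init p d
  | k + 1 =>
    if k = 0 ∨ (k + 1) % p.w = 0 then State.init p d
    else (state p a r σ k).update p (a k) (r k) (σ k)

/-- The upper confidence bound `⟨x, θ̂⟩ + β ‖x‖_{Σ̂⁻¹}` of an arm `x`. -/
def State.ucb {d : ℕ} (s : State d) (β : ℝ) (x : Vec d) : ℝ :=
  inner ℝ x s.thetaHat + β * ellNorm s.Sig⁻¹ x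

/-- The σ-algebra generated by `a_1, …, a_k` and `ε_1, …, ε_{k-1}`. -/
abbrev history {Ω : Type*} {d : ℕ} (a : ℕ → Ω → Vec d) (ε : ℕ → Ω → ℝ) (k : ℕ) :
    MeasurableSpace Ω :=
  (⨆ i ∈ Set.Icc 1 k, MeasurableSpace.comap (a i) inferInstance) ⊔
    (⨆ i ∈ Set.Ico 1 k, MeasurableSpace.comap (ε i) inferInstance)

/-- The dynamic regret over the rounds `1, …, K` along one trajectory: `aStar k` is the optimal arm
and `a k` the played arm of round `k`. -/
def regret {d : ℕ} (K : ℕ) (θ aStar a : ℕ → Vec d) : ℝ :=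
  ∑ k ∈ Finset.Icc 1 K, (inner ℝ (aStar k) (θ k) - inner ℝ (a k) (θ k))

/-- `K` rounds of the algorithm with inputs `p` in a heteroscedastic non-stationary linear bandit
on the probability space `(Ω, μ)`. `θ` are the feature vectors (fixed in advance), `D k ω` is the
arm set of round `k`, `a` and `aStar` are the played and the optimal arms, `ε` is the noise, `σ` are
the conditional standard deviations, `BK` bounds the total variation and `VK` the total variance.
The reward of round `k` is `⟨θ_k, a_k⟩ + ε_k`. -/
structure IsRun {Ω : Type*} [MeasurableSpace Ω] (μ : Measure Ω) (p : Params) {d : ℕ} (K : ℕ)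
    (BK VK : ℝ) (θ : ℕ → Vec d) (D : ℕ → Ω → Set (Vec d)) (a aStar : ℕ → Ω → Vec d)
    (ε σ : ℕ → Ω → ℝ) : Prop where
  meas_a : ∀ k ∈ Set.Icc 1 K, Measurable (a k)
  meas_noise : ∀ k ∈ Set.Icc 1 K, Measurable (ε k)
  theta_le : ∀ k ∈ Set.Icc 1 K, ‖θ k‖ ≤ p.B
  arm_le : ∀ k ∈ Set.Icc 1 K, ∀ ω, ∀ x ∈ D k ω, ‖x‖ ≤ p.A
  mean_mem : ∀ k ∈ Set.Icc 1 K, ∀ ω, ∀ x ∈ D k ω, inner ℝ x (θ k) ∈ Set.Icc (-1 : ℝ) 1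
  variation_le : ∑ k ∈ Finset.Ico 1 K, ‖θ (k + 1) - θ k‖ ≤ BK
  sigma_nonneg : ∀ k ∈ Set.Icc 1 K, ∀ ω, 0 ≤ σ k ω
  variance_le : ∀ᵐ ω ∂μ, ∑ k ∈ Finset.Icc 1 K, σ k ω ^ 2 ≤ VK
  noise_bdd : ∀ k ∈ Set.Icc 1 K, ∀ᵐ ω ∂μ, |ε k ω| ≤ p.R
  noise_mean : ∀ k ∈ Set.Icc 1 K, μ[ε k | history a ε k] =ᵐ[μ] fun _ => 0
  noise_var : ∀ k ∈ Set.Icc 1 K,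
    μ[fun ω => ε k ω ^ 2 | history a ε k] =ᵐ[μ] fun ω => σ k ω ^ 2
  opt_mem : ∀ k ∈ Set.Icc 1 K, ∀ ω, aStar k ω ∈ D k ω
  opt_max : ∀ k ∈ Set.Icc 1 K, ∀ ω, ∀ x ∈ D k ω, inner ℝ x (θ k) ≤ inner ℝ (aStar k ω) (θ k)
  play_mem : ∀ k ∈ Set.Icc 1 K, ∀ ω, a k ω ∈ D k ω
  play_max : ∀ k ∈ Set.Icc 1 K, ∀ ω, ∀ x ∈ D k ω,
    (state p (fun i => a i ω) (fun i => inner ℝ (θ i) (a i ω) + ε i ω) (fun i => σ i ω) k).ucb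
        (betaHat p d k) x ≤
      (state p (fun i => a i ω) (fun i => inner ℝ (θ i) (a i ω) + ε i ω) (fun i => σ i ω) k).ucb
        (betaHat p d k) (a k ω)

/-- The property `S` holds on a measurable event of probability at least `q`. -/
def WithProb {Ω : Type*} [MeasurableSpace Ω] (μ : Measure Ω) (q : ℝ) (S : Ω → Prop) : Prop :=
  ∃ E : Set Ω, MeasurableSet E ∧ q ≤ μ.real E ∧ ∀ ω ∈ E, S ω

end RestartedOFUL

end

open MeasureTheory
open scoped Matrix

namespace RestartedOFUL

/-- The quadratic form `vᵀ M v`. -/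
def qf {d : ℕ} (M : Matrix (Fin d) (Fin d) ℝ) (v : Fin d → ℝ) : ℝ := v ⬝ᵥ (M *ᵥ v)

section LinearAlgebra

variable {d : ℕ} {M : Matrix (Fin d) (Fin d) ℝ}

theorem qf_nonneg (hM : M.PosSemidef) (v : Fin d → ℝ) : 0 ≤ qf M v := by
  simpa [qf] using hM.dotProduct_mulVec_nonneg v

theorem dotProduct_mulVec_symm (hM : M.IsHermitian) (v u : Fin d → ℝ) :
    v ⬝ᵥ (M *ᵥ u) = u ⬝ᵥ (M *ᵥ v) := by
  have hT : Mᵀ = M := by simpa using hM.eq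
  rw [Matrix.dotProduct_mulVec, ← Matrix.mulVec_transpose, hT, dotProduct_comm]

theorem qf_add_smul (hM : M.IsHermitian) (v u : Fin d → ℝ) (t : ℝ) :
    qf M (v + t • u) = qf M v + 2 * t * (v ⬝ᵥ (M *ᵥ u)) + t ^ 2 * qf M u := by
  simp only [qf, Matrix.mulVec_add, Matrix.mulVec_smul, add_dotProduct, dotProduct_add,
    smul_dotProduct, dotProduct_smul, smul_eq_mul]
  rw [dotProduct_mulVec_symm hM u v]
  ring

theorem sq_dotProduct_mulVec_le (hM : M.PosSemidef) (v u : Fin d → ℝ) :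
    (v ⬝ᵥ (M *ᵥ u)) ^ 2 ≤ qf M v * qf M u := by
  have h : ∀ t : ℝ, 0 ≤ qf M u * (t * t) + 2 * (v ⬝ᵥ (M *ᵥ u)) * t + qf M v := fun t => by
    have := qf_nonneg hM (v + t • u)
    rw [qf_add_smul hM.isHermitian] at this
    nlinarith
  have := discrim_le_zero h
  rw [discrim] at this
  nlinarith

theorem abs_dotProduct_mulVec_le (hM : M.PosSemidef) (v u : Fin d → ℝ) :
    |v ⬝ᵥ (M *ᵥ u)| ≤ √(qf M v) * √(qf M u) := by
  rw [← Real.sqrt_mul (qf_nonneg hM v)]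
  exact Real.abs_le_sqrt (sq_dotProduct_mulVec_le hM v u)

theorem mul_inv_of_posDef (hM : M.PosDef) : M * M⁻¹ = 1 :=
  Matrix.mul_nonsing_inv _ (hM.det_pos.ne'.isUnit)

theorem mulVec_inv_mulVec (hM : M.PosDef) (v : Fin d → ℝ) : M *ᵥ (M⁻¹ *ᵥ v) = v := by
  rw [Matrix.mulVec_mulVec, mul_inv_of_posDef hM, Matrix.one_mulVec]

theorem inv_mulVec_mulVec (hM : M.PosDef) (v : Fin d → ℝ) : M⁻¹ *ᵥ (M *ᵥ v) = v := by
  rw [Matrix.mulVec_mulVec, Matrix.nonsing_inv_mul _ (hM.det_pos.ne'.isUnit), Matrix.one_mulVec]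

theorem qf_inv_mulVec (hM : M.PosDef) (v : Fin d → ℝ) : qf M (M⁻¹ *ᵥ v) = qf M⁻¹ v := by
  rw [qf, mulVec_inv_mulVec hM, dotProduct_comm, qf]

theorem qf_rankOne (M : Matrix (Fin d) (Fin d) ℝ) (c : ℝ) (a v : Fin d → ℝ) :
    qf (M + c • Matrix.vecMulVec a a) v = qf M v + c * (a ⬝ᵥ v) ^ 2 := by
  simp only [qf, Matrix.add_mulVec, Matrix.smul_mulVec, Matrix.vecMulVec_mulVec, dotProduct_add,
    dotProduct_smul, smul_eq_mul, op_smul_eq_smul]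
  rw [dotProduct_comm v a]
  ring

theorem posDef_rankOne (hM : M.PosDef) {c : ℝ} (hc : 0 ≤ c) (a : Fin d → ℝ) :
    (M + c • Matrix.vecMulVec a a).PosDef := by
  refine hM.add_posSemidef (Matrix.PosSemidef.smul ?_ hc)
  simpa using Matrix.posSemidef_vecMulVec_self_star a

/-- The Sherman-Morrison formula. -/
theorem inv_rankOne (hM : M.PosDef) {c : ℝ} (hc : 0 ≤ c) (a : Fin d → ℝ) :
    (M + c • Matrix.vecMulVec a a)⁻¹ =
      M⁻¹ + (-(c / (1 + c * qf M⁻¹ a))) • Matrix.vecMulVec (M⁻¹ *ᵥ a) (M⁻¹ *ᵥ a) := by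
  have hq := qf_nonneg hM.inv.posSemidef a
  have h1 : 0 < 1 + c * qf M⁻¹ a := by positivity
  apply Matrix.inv_eq_right_inv
  have e1 : M * Matrix.vecMulVec (M⁻¹ *ᵥ a) (M⁻¹ *ᵥ a) = Matrix.vecMulVec a (M⁻¹ *ᵥ a) := by
    rw [Matrix.mul_vecMulVec, mulVec_inv_mulVec hM]
  have hT : M⁻¹ᵀ = M⁻¹ := by simpa using hM.inv.isHermitian.eq
  have e2 : Matrix.vecMulVec a a * M⁻¹ = Matrix.vecMulVec a (M⁻¹ *ᵥ a) := by
    rw [Matrix.vecMulVec_mul, ← Matrix.mulVec_transpose, hT]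
  have e3 : Matrix.vecMulVec a a * Matrix.vecMulVec (M⁻¹ *ᵥ a) (M⁻¹ *ᵥ a) =
      qf M⁻¹ a • Matrix.vecMulVec a (M⁻¹ *ᵥ a) := by
    rw [Matrix.vecMulVec_mul_vecMulVec, qf, Matrix.vecMulVec_smul]
  rw [Matrix.add_mul, Matrix.mul_add, Matrix.mul_add, mul_inv_of_posDef hM, Matrix.mul_smul, e1,
    Matrix.smul_mul, Matrix.smul_mul, e2, Matrix.mul_smul, e3, add_assoc, ← smul_assoc, ← smul_assoc,
    ← add_smul, ← add_smul]
  convert add_zero _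
  convert zero_smul ℝ _
  simp only [smul_eq_mul]
  field_simp
  ring

theorem qf_inv_rankOne_le (hM : M.PosDef) {c : ℝ} (hc : 0 ≤ c) (a s : Fin d → ℝ) (e : ℝ) :
    qf (M + c • Matrix.vecMulVec a a)⁻¹ (s + (c * e) • a) ≤
      qf M⁻¹ s + 2 * c * (s ⬝ᵥ (M⁻¹ *ᵥ a)) / (1 + c * qf M⁻¹ a) * e +
        c * (c * qf M⁻¹ a) / (1 + c * qf M⁻¹ a) * e ^ 2 := by
  have hq := qf_nonneg hM.inv.posSemidef a
  have h1 : 0 < 1 + c * qf M⁻¹ a := by positivity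
  have e1 : (M⁻¹ *ᵥ a) ⬝ᵥ (s + (c * e) • a) = s ⬝ᵥ (M⁻¹ *ᵥ a) + c * e * qf M⁻¹ a := by
    rw [dotProduct_comm, add_dotProduct, smul_dotProduct, smul_eq_mul, qf]
  rw [inv_rankOne hM hc, qf_rankOne, qf_add_smul hM.inv.isHermitian, e1]
  set q := qf M⁻¹ a
  set h := s ⬝ᵥ (M⁻¹ *ᵥ a)
  have : 0 ≤ c / (1 + c * q) * h ^ 2 := by positivity
  have key : qf M⁻¹ s + 2 * c * h / (1 + c * q) * e + c * (c * q) / (1 + c * q) * e ^ 2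
      - (qf M⁻¹ s + 2 * (c * e) * h + (c * e) ^ 2 * q + -(c / (1 + c * q)) * (h + c * e * q) ^ 2)
      = c / (1 + c * q) * h ^ 2 := by
    field_simp
    ring
  linarith

theorem det_rankOne (hM : M.PosDef) (c : ℝ) (a : Fin d → ℝ) :
    (M + c • Matrix.vecMulVec a a).det = M.det * (1 + c * qf M⁻¹ a) := by
  have h := Matrix.det_add_replicateCol_mul_replicateRow (ι := Unit) (A := M)
    (hM.det_pos.ne'.isUnit) (c • a) a
  rw [← Matrix.vecMulVec_eq, Matrix.smul_vecMulVec] at h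
  rw [h]
  congr 1
  simp only [Matrix.det_unique, Matrix.add_apply, Matrix.one_apply_eq, Matrix.mul_apply,
    Matrix.replicateRow_apply, Matrix.replicateCol_apply, Pi.smul_apply, smul_eq_mul, qf,
    dotProduct, Matrix.mulVec, Finset.mul_sum, Finset.sum_mul]
  congr 1
  rw [Finset.sum_comm]
  exact Finset.sum_congr rfl fun i _ => Finset.sum_congr rfl fun j _ => by ring

theorem trace_rankOne (c : ℝ) (a : Fin d → ℝ) :
    (M + c • Matrix.vecMulVec a a).trace = M.trace + c * (a ⬝ᵥ a) := by
  rw [Matrix.trace_add, Matrix.trace_smul, Matrix.trace_vecMulVec, smul_eq_mul]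

theorem log_det_le (hd : 1 ≤ d) (hM : M.PosDef) :
    Real.log M.det ≤ d * Real.log (M.trace / d) := by
  have hd0 : (0 : ℝ) < d := by exact_mod_cast hd
  have hpos := hM.eigenvalues_pos
  have hdet : M.det = ∏ i, hM.isHermitian.eigenvalues i := by
    simpa using hM.isHermitian.det_eq_prod_eigenvalues
  have htr : M.trace = ∑ i, hM.isHermitian.eigenvalues i := by
    simpa using hM.isHermitian.trace_eq_sum_eigenvalues
  have hS : 0 < M.trace := by
    rw [htr]
    exact Finset.sum_pos (fun i _ => hpos i) ⟨⟨0, hd⟩, Finset.mem_univ _⟩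
  have key : ∀ i, Real.log (hM.isHermitian.eigenvalues i) - Real.log (M.trace / d) ≤
      hM.isHermitian.eigenvalues i / (M.trace / d) - 1 := fun i => by
    rw [← Real.log_div (hpos i).ne' (by positivity)]
    exact Real.log_le_sub_one_of_pos (div_pos (hpos i) (by positivity))
  have := Finset.sum_le_sum fun i (_ : i ∈ Finset.univ) => key i
  rw [Finset.sum_sub_distrib, Finset.sum_sub_distrib, ← Finset.sum_div, ← htr] at this
  simp only [Finset.sum_const, Finset.card_univ, Fintype.card_fin, nsmul_eq_mul] at this
  rw [hdet, Real.log_prod fun i _ => (hpos i).ne']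
  have e : M.trace / (M.trace / d) = d := by field_simp
  linarith

theorem qf_inv_le (hM : M.PosDef) {l : ℝ} (hl : 0 < l) (h : ∀ v, l * (v ⬝ᵥ v) ≤ qf M v)
    (v : Fin d → ℝ) : qf M⁻¹ v ≤ (v ⬝ᵥ v) / l := by
  have h1 := h (M⁻¹ *ᵥ v)
  rw [qf_inv_mulVec hM] at h1
  have hy : 0 ≤ (M⁻¹ *ᵥ v) ⬝ᵥ (M⁻¹ *ᵥ v) := by
    simpa using dotProduct_star_self_nonneg (M⁻¹ *ᵥ v)
  have hv : 0 ≤ v ⬝ᵥ v := by simpa using dotProduct_star_self_nonneg v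
  have h2 : (qf M⁻¹ v) ^ 2 ≤ (v ⬝ᵥ v) * ((M⁻¹ *ᵥ v) ⬝ᵥ (M⁻¹ *ᵥ v)) := by
    have := sq_dotProduct_mulVec_le (M := 1) Matrix.PosSemidef.one v (M⁻¹ *ᵥ v)
    simpa [qf] using this
  have hq := qf_nonneg hM.inv.posSemidef v
  rw [le_div_iff₀ hl]
  rcases hq.eq_or_lt with h0 | h0
  · rw [← h0]; simpa using hv
  · have : qf M⁻¹ v * (qf M⁻¹ v * l) ≤ qf M⁻¹ v * (v ⬝ᵥ v) := by nlinarith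
    exact le_of_mul_le_mul_left this h0

end LinearAlgebra

end RestartedOFUL

namespace RestartedOFUL

theorem succ_mod_of_ne {w k : ℕ} (h : (k + 1) % w ≠ 0) : (k + 1) % w = k % w + 1 := by
  rcases Nat.eq_zero_or_pos w with rfl | hw'
  · simp
  have h1 : k % w < w := Nat.mod_lt k hw'
  rw [Nat.add_mod_eq_ite] at h ⊢
  rcases Nat.lt_or_ge 1 w with h2 | h2
  · rw [Nat.mod_eq_of_lt h2] at h ⊢
    split_ifs at h ⊢ with h3 <;> omega
  · obtain rfl : w = 1 := by omega
    simp [Nat.mod_one] at h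

theorem succ_div_of_ne {w k : ℕ} (h : (k + 1) % w ≠ 0) : (k + 1) / w = k / w := by
  rw [Nat.succ_div, if_neg fun h' => h (Nat.mod_eq_zero_of_dvd h'), add_zero]

theorem succ_div_of_eq {w k : ℕ} (h : (k + 1) % w = 0) : (k + 1) / w = k / w + 1 := by
  rw [Nat.succ_div, if_pos (Nat.dvd_of_mod_eq_zero h)]

namespace State

variable {d : ℕ}

/-- The regression weight `1 / σ̄²`. -/
noncomputable def wt (p : Params) (s : State d) (a : Vec d) (σ : ℝ) : ℝ := 1 / s.sigmaBar p a σ ^ 2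

/-- The elliptical potential `‖a / σ̄‖²_{Σ̂⁻¹}`. -/
noncomputable def pot (p : Params) (s : State d) (a : Vec d) (σ : ℝ) : ℝ := s.wt p a σ * qf s.Sig⁻¹ a.ofLp

/-- The normalized log-determinant of `Σ̂`. -/
noncomputable def logDet (p : Params) (s : State d) : ℝ := Real.log s.Sig.det - d * Real.log p.lam

/-- The matrix of a state is at least `λ I`. -/
structure Reg (p : Params) (s : State d) : Prop where
  posDef : s.Sig.PosDef
  le_qf : ∀ v, p.lam * (v ⬝ᵥ v) ≤ qf s.Sig v

variable {p : Params} {s : State d} {a : Vec d} {σ : ℝ}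

theorem alpha_le_sigmaBar : p.alpha ≤ s.sigmaBar p a σ :=
  (le_max_right _ _).trans (le_max_left _ _)

theorem le_sigmaBar : σ ≤ s.sigmaBar p a σ := (le_max_left _ _).trans (le_max_left _ _)

theorem sigmaBar_pos (hp : p.Valid) : 0 < s.sigmaBar p a σ :=
  hp.alpha_pos.trans_le alpha_le_sigmaBar

theorem wt_pos (hp : p.Valid) : 0 < s.wt p a σ := by
  have := sigmaBar_pos (s := s) (a := a) (σ := σ) hp
  unfold wt; positivity

theorem wt_le (hp : p.Valid) : s.wt p a σ ≤ 1 / p.alpha ^ 2 := by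
  have := hp.alpha_pos
  unfold wt
  gcongr
  exact alpha_le_sigmaBar

theorem wt_mul_sq_le_one (hp : p.Valid) (hσ : 0 ≤ σ) : s.wt p a σ * σ ^ 2 ≤ 1 := by
  have h := sigmaBar_pos (s := s) (a := a) (σ := σ) hp
  rw [wt, one_div, inv_mul_le_one₀ (by positivity)]
  exact pow_le_pow_left₀ hσ le_sigmaBar 2

theorem wt_mul_ellNorm_le (hp : p.Valid) :
    s.wt p a σ * √(qf s.Sig⁻¹ a.ofLp) ≤ 1 / p.gamma ^ 2 := by
  have h := sigmaBar_pos (s := s) (a := a) (σ := σ) hp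
  have hg := hp.gamma_pos
  rw [wt, one_div_mul_eq_div, div_le_div_iff₀ (by positivity) (by positivity)]
  have h1 : p.gamma * √(ellNorm s.Sig⁻¹ a) ≤ s.sigmaBar p a σ := le_max_right _ _
  have h2 := pow_le_pow_left₀ (by positivity) h1 2
  have h3 : (0 : ℝ) ≤ ellNorm s.Sig⁻¹ a := Real.sqrt_nonneg _
  rw [mul_pow, Real.sq_sqrt h3] at h2
  have h4 : ellNorm s.Sig⁻¹ a = √(qf s.Sig⁻¹ a.ofLp) := rfl
  rw [h4] at h2
  linarith

theorem update_Sig (r : ℝ) : (s.update p a r σ).Sig =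
    s.Sig + s.wt p a σ • Matrix.vecMulVec a.ofLp a.ofLp := rfl

theorem update_b (r : ℝ) : (s.update p a r σ).b = s.b + (s.wt p a σ * r) • a.ofLp := by
  rw [wt, one_div_mul_eq_div]; rfl

theorem dotProduct_self_eq (a : Vec d) : a.ofLp ⬝ᵥ a.ofLp = ‖a‖ ^ 2 := by
  rw [EuclideanSpace.real_norm_sq_eq]
  simp [dotProduct, sq]

theorem inner_eq_dotProduct (x y : Vec d) : inner ℝ x y = x.ofLp ⬝ᵥ y.ofLp := by
  rw [EuclideanSpace.inner_eq_star_dotProduct]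
  simp [dotProduct_comm]

theorem reg_init (hp : p.Valid) : (State.init p d).Reg p where
  posDef := Matrix.PosDef.smul Matrix.PosDef.one hp.lam_pos
  le_qf v := by simp [qf, State.init, Matrix.smul_mulVec]

theorem Reg.update (hs : s.Reg p) (hp : p.Valid) (r : ℝ) : (s.update p a r σ).Reg p where
  posDef := by
    rw [update_Sig]
    exact posDef_rankOne hs.posDef (wt_pos hp).le _
  le_qf v := by
    have := hs.le_qf v
    rw [update_Sig, qf_rankOne]
    have := wt_pos (s := s) (a := a) (σ := σ) hp
    have : 0 ≤ s.wt p a σ * (a.ofLp ⬝ᵥ v) ^ 2 := by positivity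
    linarith

theorem Reg.qf_inv_nonneg (hs : s.Reg p) (v : Fin d → ℝ) : 0 ≤ qf s.Sig⁻¹ v :=
  qf_nonneg hs.posDef.inv.posSemidef v

theorem Reg.qf_inv_le (hs : s.Reg p) (hp : p.Valid) (a : Vec d) :
    qf s.Sig⁻¹ a.ofLp ≤ ‖a‖ ^ 2 / p.lam := by
  rw [← dotProduct_self_eq]
  exact RestartedOFUL.qf_inv_le hs.posDef hp.lam_pos hs.le_qf _

theorem Reg.pot_nonneg (hs : s.Reg p) (hp : p.Valid) : 0 ≤ s.pot p a σ :=
  mul_nonneg (wt_pos hp).le (hs.qf_inv_nonneg _)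

theorem logDet_init : (State.init p d).logDet p = 0 := by
  have h : (State.init p d).Sig.det = p.lam ^ d := by simp [State.init]
  rw [logDet, h, Real.log_pow, sub_self]

theorem Reg.logDet_update (hs : s.Reg p) (hp : p.Valid) (r : ℝ) :
    (s.update p a r σ).logDet p = s.logDet p + Real.log (1 + s.pot p a σ) := by
  have := hs.pot_nonneg (a := a) (σ := σ) hp
  rw [logDet, update_Sig, det_rankOne hs.posDef]
  change Real.log (_ * (1 + s.pot p a σ)) - _ = _
  rw [Real.log_mul hs.posDef.det_pos.ne' (by positivity), logDet]
  ring

theorem Reg.logDet_le (hs : s.Reg p) (hp : p.Valid) (hd : 1 ≤ d) {x : ℝ}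
    (h : s.Sig.trace ≤ d * p.lam + x) : s.logDet p ≤ d * Real.log (1 + x / (d * p.lam)) := by
  have hd0 : (0 : ℝ) < d := by exact_mod_cast hd
  have hl := hp.lam_pos
  have htr : 0 < s.Sig.trace := by
    have : Nonempty (Fin d) := ⟨⟨0, hd⟩⟩
    exact hs.posDef.trace_pos
  have h1 := log_det_le hd hs.posDef
  have h2 : Real.log (s.Sig.trace / d) ≤ Real.log (p.lam * (1 + x / (d * p.lam))) := by
    apply Real.log_le_log (by positivity)
    rw [div_le_iff₀ hd0]
    have e : p.lam * (1 + x / (d * p.lam)) * d = d * p.lam + x := by field_simp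
    rwa [e]
  have h3 : 0 < 1 + x / (d * p.lam) := by
    have : 0 < (d * p.lam + x) / (d * p.lam) := div_pos (htr.trans_le h) (by positivity)
    rwa [add_div, div_self (by positivity)] at this
  rw [Real.log_mul hl.ne' h3.ne'] at h2
  rw [logDet]
  nlinarith

end State

section Trajectory

variable {p : Params} {d : ℕ} {a : ℕ → Vec d} {r σ : ℕ → ℝ}

theorem state_restart {k : ℕ} (h : k ≤ 1 ∨ k % p.w = 0) : state p a r σ k = State.init p d := by
  cases k with
  | zero => rfl
  | succ k => rw [state, if_pos (by omega)]

theorem state_succ {k : ℕ} (hk : 1 ≤ k) (h : (k + 1) % p.w ≠ 0) :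
    state p a r σ (k + 1) = (state p a r σ k).update p (a k) (r k) (σ k) := by
  rw [state, if_neg (by omega)]

/-- Induction along the rounds of the algorithm: a property that holds after initialization and
restarts, and is preserved by the updates, holds in all rounds. -/
theorem round_induction (p : Params) {P : ℕ → Prop}
    (restart : ∀ k, k ≤ 1 ∨ k % p.w = 0 → P k)
    (step : ∀ k, 1 ≤ k → (k + 1) % p.w ≠ 0 → P k → P (k + 1)) (k : ℕ) : P k := by
  induction k with
  | zero => exact restart 0 (by simp)
  | succ k ih =>
    by_cases h : k + 1 ≤ 1 ∨ (k + 1) % p.w = 0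
    · exact restart _ h
    · exact step k (by omega) (by omega) ih

theorem state_Sig (r r' : ℕ → ℝ) (k : ℕ) :
    (state p a r σ k).Sig = (state p a r' σ k).Sig := by
  induction k using round_induction p with
  | restart k h => rw [state_restart h, state_restart h]
  | step k hk h ih =>
    rw [state_succ hk h, state_succ hk h, State.update_Sig, State.update_Sig, ih, State.wt,
      State.wt, State.sigmaBar, State.sigmaBar, ih]

theorem reg_state (hp : p.Valid) (k : ℕ) : (state p a r σ k).Reg p := by
  induction k using round_induction p with
  | restart k h => rw [state_restart h]; exact State.reg_init hp
  | step k hk h ih => rw [state_succ hk h]; exact ih.update hp _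

theorem trace_update_le (hp : p.Valid) {s : State d} {x : Vec d} (hx : ‖x‖ ≤ p.A) (y z : ℝ) {n : ℕ}
    (h : s.Sig.trace ≤ d * p.lam + n * p.A ^ 2 / p.alpha ^ 2) :
    (s.update p x y z).Sig.trace ≤ d * p.lam + (n + 1 : ℕ) * p.A ^ 2 / p.alpha ^ 2 := by
  rw [State.update_Sig, trace_rankOne, State.dotProduct_self_eq]
  have h1 : s.wt p x z * ‖x‖ ^ 2 ≤ 1 / p.alpha ^ 2 * p.A ^ 2 := by
    have := hp.alpha_pos
    gcongr
    exact State.wt_le hp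
  have h2 : ((n + 1 : ℕ) : ℝ) * p.A ^ 2 / p.alpha ^ 2 =
      n * p.A ^ 2 / p.alpha ^ 2 + 1 / p.alpha ^ 2 * p.A ^ 2 := by push_cast; ring
  linarith

theorem trace_state_le (hp : p.Valid) {k : ℕ} (ha : ∀ i, 1 ≤ i → i < k → ‖a i‖ ≤ p.A) :
    (state p a r σ k).Sig.trace ≤ d * p.lam + (k % p.w : ℕ) * p.A ^ 2 / p.alpha ^ 2 := by
  induction k using round_induction p with
  | restart k h =>
    rw [state_restart h]
    have : 0 ≤ (k % p.w : ℕ) * p.A ^ 2 / p.alpha ^ 2 := by positivity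
    simp only [State.init, Matrix.trace_smul, Matrix.trace_one, Fintype.card_fin, smul_eq_mul]
    linarith
  | step k hk h ih =>
    rw [state_succ hk h, succ_mod_of_ne h]
    exact trace_update_le hp (ha k hk (by omega)) _ _ (ih fun i h1 h2 => ha i h1 (by omega))

theorem logDet_state_le (hp : p.Valid) (hd : 1 ≤ d) {k : ℕ}
    (ha : ∀ i, 1 ≤ i → i < k → ‖a i‖ ≤ p.A) :
    (state p a r σ k).logDet p ≤
      d * Real.log (1 + (k % p.w : ℕ) * p.A ^ 2 / (p.alpha ^ 2 * d * p.lam)) := by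
  have := (reg_state hp k).logDet_le hp hd (trace_state_le (r := r) (σ := σ) hp ha)
  rwa [div_div, ← mul_assoc] at this

theorem logDet_update_le (hp : p.Valid) (hd : 1 ≤ d) {k : ℕ}
    (ha : ∀ i, 1 ≤ i → i ≤ k → ‖a i‖ ≤ p.A) (hk : 1 ≤ k) (y z : ℝ) :
    ((state p a r σ k).update p (a k) y z).logDet p ≤ d * iota p d := by
  have hw := hp.one_le_w
  have := ((reg_state (a := a) (r := r) (σ := σ) hp k).update (a := a k) (σ := z) hp y).logDet_le
    hp hd (trace_update_le hp (ha k hk le_rfl) y z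
      (trace_state_le (r := r) (σ := σ) hp fun i h1 h2 => ha i h1 h2.le))
  refine this.trans ?_
  have hd0 : (0 : ℝ) < d := by exact_mod_cast hd
  have hl := hp.lam_pos
  have hal := hp.alpha_pos
  have hm : ((k % p.w + 1 : ℕ) : ℝ) ≤ p.w := by exact_mod_cast Nat.mod_lt k hw
  rw [iota, div_div, mul_comm (p.alpha ^ 2)]
  gcongr

theorem iota_nonneg (hp : p.Valid) : 0 ≤ iota p d := by
  have hl := hp.lam_pos
  exact Real.log_nonneg (le_add_of_nonneg_right (by positivity))

/-- The elliptical potential lemma over all windows. -/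
theorem sum_log_pot_le (hp : p.Valid) (hd : 1 ≤ d) (k : ℕ)
    (ha : ∀ i, 1 ≤ i → i ≤ k → ‖a i‖ ≤ p.A) :
    ∑ i ∈ Finset.Icc 1 k, Real.log (1 + (state p a r σ i).pot p (a i) (σ i)) ≤
      ((k / p.w : ℕ) + 1) * (d * iota p d) := by
  have hi : 0 ≤ d * iota p d := mul_nonneg (by positivity) (iota_nonneg hp)
  rcases Nat.eq_zero_or_pos k with rfl | hk
  · simpa using hi
  have key : ∑ i ∈ Finset.Icc 1 k, Real.log (1 + (state p a r σ i).pot p (a i) (σ i)) ≤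
      (k / p.w : ℕ) * (d * iota p d) +
        ((state p a r σ k).update p (a k) (r k) (σ k)).logDet p := by
    induction k, hk using Nat.le_induction with
    | base =>
      change ∑ i ∈ Finset.Icc 1 1, _ ≤ ((1 / p.w : ℕ) : ℝ) * (d * iota p d) +
        ((state p a r σ 1).update p (a 1) (r 1) (σ 1)).logDet p
      rw [(reg_state hp 1).logDet_update hp, state_restart (k := 1) (by simp), State.logDet_init]
      rw [Finset.Icc_self, Finset.sum_singleton, state_restart (k := 1) (by simp), zero_add]
      have : 0 ≤ ((1 / p.w : ℕ) : ℝ) * (d * iota p d) := by positivity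
      linarith
    | succ k hk ih =>
      have ih := ih fun i h1 h2 => ha i h1 (by omega)
      rw [Finset.sum_Icc_succ_top (by omega), (reg_state hp (k + 1)).logDet_update hp]
      by_cases h : (k + 1) % p.w = 0
      · have := logDet_update_le (r := r) (σ := σ) hp hd (k := k)
          (fun i h1 h2 => ha i h1 (by omega)) hk (r k) (σ k)
        rw [state_restart (k := k + 1) (.inr h), State.logDet_init, succ_div_of_eq h]
        push_cast
        linarith
      · rw [succ_div_of_ne h, state_succ hk h]
        linarith
  have := logDet_update_le (r := r) (σ := σ) hp hd ha hk (r k) (σ k)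
  linarith

end Trajectory

end RestartedOFUL

namespace RestartedOFUL

/-- The variation of the feature vectors since the last restart. -/
noncomputable def winVar {d : ℕ} (p : Params) (θ : ℕ → Vec d) : ℕ → ℝ
  | 0 => 0
  | k + 1 => if k = 0 ∨ (k + 1) % p.w = 0 then 0 else winVar p θ k + ‖θ (k + 1) - θ k‖

/-- The rewards `⟨θ_k, a_k⟩ + ε_k`. -/
noncomputable abbrev reward {d : ℕ} (θ a : ℕ → Vec d) (ε : ℕ → ℝ) (i : ℕ) : ℝ := inner ℝ (θ i) (a i) + ε i

variable {p : Params} {d : ℕ} {θ a : ℕ → Vec d} {ε σ : ℕ → ℝ}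

theorem winVar_restart {k : ℕ} (h : k ≤ 1 ∨ k % p.w = 0) : winVar p θ k = 0 := by
  cases k with
  | zero => rfl
  | succ k => rw [winVar, if_pos (by omega)]

theorem winVar_succ {k : ℕ} (hk : 1 ≤ k) (h : (k + 1) % p.w ≠ 0) :
    winVar p θ (k + 1) = winVar p θ k + ‖θ (k + 1) - θ k‖ := by
  rw [winVar, if_neg (by omega)]

theorem winVar_nonneg (k : ℕ) : 0 ≤ winVar p θ k := by
  induction k using round_induction p with
  | restart k h => rw [winVar_restart h]
  | step k hk h ih => rw [winVar_succ hk h]; positivity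

theorem sum_winVar_le (hp : p.Valid) {K : ℕ} (hK : 1 ≤ K) :
    ∑ k ∈ Finset.Icc 1 K, winVar p θ k ≤ p.w * ∑ k ∈ Finset.Ico 1 K, ‖θ (k + 1) - θ k‖ := by
  have hmod (k : ℕ) : (0 : ℝ) ≤ p.w - 1 - (k % p.w : ℕ) := by
    have : ((k % p.w + 1 : ℕ) : ℝ) ≤ p.w := by exact_mod_cast Nat.mod_lt k hp.one_le_w
    push_cast at this
    linarith
  have key : ∑ k ∈ Finset.Icc 1 K, winVar p θ k + (p.w - 1 - (K % p.w : ℕ)) * winVar p θ K ≤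
      p.w * ∑ k ∈ Finset.Ico 1 K, ‖θ (k + 1) - θ k‖ := by
    induction K, hK using Nat.le_induction with
    | base =>
      simp [winVar_restart (p := p) (θ := θ) (k := 1) (by simp)]
    | succ K hK ih =>
      have hδ : 0 ≤ ‖θ (K + 1) - θ K‖ := norm_nonneg _
      have hv := winVar_nonneg (p := p) (θ := θ) K
      have h0 := mul_nonneg (hmod K) hv
      rw [Finset.sum_Icc_succ_top (by omega), Finset.sum_Ico_succ_top hK, mul_add]
      by_cases h : (K + 1) % p.w = 0
      · rw [winVar_restart (k := K + 1) (.inr h)]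
        have : 0 ≤ (p.w : ℝ) * ‖θ (K + 1) - θ K‖ := by positivity
        linarith
      · rw [winVar_succ hK h, succ_mod_of_ne h]
        have : 0 ≤ (1 + (K % p.w : ℕ) : ℝ) * ‖θ (K + 1) - θ K‖ := by positivity
        push_cast
        linarith
  have := mul_nonneg (hmod K) (winVar_nonneg (p := p) (θ := θ) K)
  linarith

theorem sqrt_mul_sqrt_add_le {n Q t : ℝ} (hn : 0 ≤ n) (hQ : 0 ≤ Q) :
    √n * √Q + t ≤ √(n + 1) * √(Q + t ^ 2) := by
  rw [← Real.sqrt_mul (x := n + 1) (by positivity)]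
  apply Real.le_sqrt_of_sq_le
  have h1 := Real.sq_sqrt hn
  have h2 := Real.sq_sqrt hQ
  have h3 : (√n * √Q) ^ 2 = n * Q := by rw [mul_pow, h1, h2]
  nlinarith [sq_nonneg (√n * t - √Q)]

/-- The bias that the drift of the feature vectors causes in the regression vector. -/
theorem abs_drift_le (hp : p.Valid) {k : ℕ} (ha : ∀ i, 1 ≤ i → i < k → ‖a i‖ ≤ p.A)
    (v : Fin d → ℝ) (θ' : Vec d) {m : ℝ} (hm : winVar p θ k + ‖θ k - θ'‖ ≤ m) :
    |v ⬝ᵥ ((state p a (reward θ a ε) σ k).b - (state p a ε σ k).b -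
        ((state p a ε σ k).Sig *ᵥ θ'.ofLp - p.lam • θ'.ofLp))| ≤
      m * (p.A / p.alpha) * (√(k % p.w : ℕ) *
        √(qf (state p a ε σ k).Sig v - p.lam * (v ⬝ᵥ v))) := by
  induction k using round_induction p generalizing m with
  | restart k h =>
    rw [state_restart h, state_restart h]
    have : 0 ≤ m := (by positivity : 0 ≤ ‖θ k - θ'‖).trans (by
      rw [winVar_restart h] at hm; linarith)
    have := hp.A_nonneg
    have := hp.alpha_pos
    simp only [State.init, Matrix.smul_mulVec, Matrix.one_mulVec, sub_self, dotProduct_zero,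
      abs_zero]
    positivity
  | step k hk h ih =>
    have hw := winVar_nonneg (p := p) (θ := θ) k
    rw [winVar_succ hk h] at hm
    have htri : ‖θ k - θ'‖ ≤ ‖θ (k + 1) - θ k‖ + ‖θ (k + 1) - θ'‖ := by
      have := norm_sub_le (θ (k + 1) - θ') (θ (k + 1) - θ k)
      rw [show θ (k + 1) - θ' - (θ (k + 1) - θ k) = θ k - θ' by abel] at this
      linarith
    have ih := ih (fun i h1 h2 => ha i h1 (by omega)) (m := m) (by linarith)
    have hmk : ‖θ k - θ'‖ ≤ m := by linarith
    have hm0 : 0 ≤ m := (norm_nonneg _).trans hmk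
    have hA := hp.A_nonneg
    have hal := hp.alpha_pos
    have hak := ha k hk (by omega)
    have hreg := reg_state (p := p) (a := a) (r := ε) (σ := σ) hp k
    have hSig := state_Sig (p := p) (a := a) (σ := σ) (reward θ a ε) ε k
    rw [state_succ hk h, state_succ hk h, State.update_b, State.update_b, State.update_Sig,
      succ_mod_of_ne h, qf_rankOne]
    have hwt : (state p a (reward θ a ε) σ k).wt p (a k) (σ k) =
        (state p a ε σ k).wt p (a k) (σ k) := by
      rw [State.wt, State.wt, State.sigmaBar, State.sigmaBar, hSig]
    rw [hwt]
    set s := state p a ε σ k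
    set c := s.wt p (a k) (σ k) with hc
    have hc0 : 0 < c := State.wt_pos hp
    have hc1 : √c ≤ 1 / p.alpha := by
      rw [Real.sqrt_le_left (by positivity), one_div_pow]
      exact State.wt_le hp
    have hin : inner ℝ (θ k) (a k) = (a k).ofLp ⬝ᵥ (θ k).ofLp := by
      rw [State.inner_eq_dotProduct, dotProduct_comm]
    have e : v ⬝ᵥ ((state p a (reward θ a ε) σ k).b + (c * reward θ a ε k) • (a k).ofLp -
        (s.b + (c * ε k) • (a k).ofLp) -
        ((s.Sig + c • Matrix.vecMulVec (a k).ofLp (a k).ofLp) *ᵥ θ'.ofLp - p.lam • θ'.ofLp)) =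
        v ⬝ᵥ ((state p a (reward θ a ε) σ k).b - s.b - (s.Sig *ᵥ θ'.ofLp - p.lam • θ'.ofLp)) +
        c * inner ℝ (a k) (θ k - θ') * ((a k).ofLp ⬝ᵥ v) := by
      rw [inner_sub_right, State.inner_eq_dotProduct, State.inner_eq_dotProduct, reward, hin,
        dotProduct_comm (a k).ofLp v]
      simp only [Matrix.add_mulVec, Matrix.smul_mulVec, Matrix.vecMulVec_mulVec, dotProduct_add,
        dotProduct_sub, dotProduct_smul, smul_eq_mul, op_smul_eq_smul]
      ring
    rw [e]
    have hQ := hreg.le_qf v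
    have h1 := sqrt_mul_sqrt_add_le (n := (k % p.w : ℕ)) (Q := qf s.Sig v - p.lam * (v ⬝ᵥ v))
      (t := √c * |(a k).ofLp ⬝ᵥ v|) (by positivity) (by linarith)
    rw [mul_pow, Real.sq_sqrt hc0.le, sq_abs] at h1
    have h2 : |c * inner ℝ (a k) (θ k - θ') * ((a k).ofLp ⬝ᵥ v)| ≤
        m * (p.A / p.alpha) * (√c * |(a k).ofLp ⬝ᵥ v|) := by
      rw [abs_mul, abs_mul, abs_of_pos hc0]
      have h3 : |inner ℝ (a k) (θ k - θ')| ≤ p.A * m :=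
        (abs_real_inner_le_norm _ _).trans (by gcongr)
      calc c * |inner ℝ (a k) (θ k - θ')| * |(a k).ofLp ⬝ᵥ v|
          ≤ c * (p.A * m) * |(a k).ofLp ⬝ᵥ v| := by gcongr
        _ = √c * (p.A * m) * (√c * |(a k).ofLp ⬝ᵥ v|) := by
            nth_rewrite 1 [← Real.mul_self_sqrt hc0.le]; ring
        _ ≤ 1 / p.alpha * (p.A * m) * (√c * |(a k).ofLp ⬝ᵥ v|) := by gcongr
        _ = _ := by ring
    refine (abs_add_le _ _).trans ?_
    calc _ ≤ m * (p.A / p.alpha) * (√(k % p.w : ℕ) * √(qf s.Sig v - p.lam * (v ⬝ᵥ v))) +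
          m * (p.A / p.alpha) * (√c * |(a k).ofLp ⬝ᵥ v|) := add_le_add ih h2
      _ = m * (p.A / p.alpha) * (√(k % p.w : ℕ) * √(qf s.Sig v - p.lam * (v ⬝ᵥ v)) +
          √c * |(a k).ofLp ⬝ᵥ v|) := by ring
      _ ≤ m * (p.A / p.alpha) * (√((k % p.w : ℕ) + 1) *
          √(qf s.Sig v - p.lam * (v ⬝ᵥ v) + c * ((a k).ofLp ⬝ᵥ v) ^ 2)) := by gcongr
      _ = _ := by push_cast; ring_nf

/-- The self-normalized noise `‖∑ a_s ε_s / σ̄_s²‖²_{Σ̂⁻¹}` before round `k`. -/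
noncomputable def noiseSq (p : Params) (a : ℕ → Vec d) (ε σ : ℕ → ℝ) (k : ℕ) : ℝ :=
  qf (state p a ε σ k).Sig⁻¹ (state p a ε σ k).b

/-- The bias bound of a round, per unit of variation. -/
noncomputable def biasCoeff (p : Params) : ℝ := p.A ^ 2 * √p.w / (p.alpha * √p.lam)

theorem abs_estimate_sub_le (hp : p.Valid) {k : ℕ}
    (ha : ∀ i, 1 ≤ i → i < k → ‖a i‖ ≤ p.A) (hθ : ‖θ k‖ ≤ p.B) {x : Vec d} (hx : ‖x‖ ≤ p.A) :
    |inner ℝ x (state p a (reward θ a ε) σ k).thetaHat - inner ℝ x (θ k)| ≤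
      (√(noiseSq p a ε σ k) + √p.lam * p.B) *
        ellNorm (state p a (reward θ a ε) σ k).Sig⁻¹ x + biasCoeff p * winVar p θ k := by
  have hdrift := abs_drift_le (ε := ε) (σ := σ) hp ha
    ((state p a ε σ k).Sig⁻¹ *ᵥ x.ofLp) (θ k) (m := winVar p θ k) (θ := θ) (by simp)
  have hreg := reg_state (p := p) (a := a) (r := ε) (σ := σ) hp k
  rw [State.inner_eq_dotProduct, State.inner_eq_dotProduct, State.thetaHat, noiseSq,
    state_Sig (reward θ a ε) ε k]
  set s := state p a ε σ k
  set b := (state p a (reward θ a ε) σ k).b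
  have hA := hp.A_nonneg
  have hB := hp.B_nonneg
  have hl := hp.lam_pos
  have hal := hp.alpha_pos
  have hpsd := hreg.posDef.inv.posSemidef
  have hv := winVar_nonneg (p := p) (θ := θ) k
  have hsymm (y : Fin d → ℝ) : (s.Sig⁻¹ *ᵥ x.ofLp) ⬝ᵥ y = x.ofLp ⬝ᵥ (s.Sig⁻¹ *ᵥ y) := by
    rw [dotProduct_comm, dotProduct_mulVec_symm hpsd.isHermitian]
  have e : x.ofLp ⬝ᵥ (s.Sig⁻¹ *ᵥ b) - x.ofLp ⬝ᵥ (θ k).ofLp =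
      x.ofLp ⬝ᵥ (s.Sig⁻¹ *ᵥ s.b) - p.lam * (x.ofLp ⬝ᵥ (s.Sig⁻¹ *ᵥ (θ k).ofLp)) +
      (s.Sig⁻¹ *ᵥ x.ofLp) ⬝ᵥ (b - s.b - (s.Sig *ᵥ (θ k).ofLp - p.lam • (θ k).ofLp)) := by
    rw [hsymm]
    simp only [Matrix.mulVec_sub, Matrix.mulVec_smul, dotProduct_sub, dotProduct_smul, smul_eq_mul,
      inv_mulVec_mulVec hreg.posDef]
    ring
  change |x.ofLp ⬝ᵥ (s.Sig⁻¹ *ᵥ b) - x.ofLp ⬝ᵥ (θ k).ofLp| ≤ _ * √(qf s.Sig⁻¹ x.ofLp) + _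
  rw [e]
  have hqx : 0 ≤ qf s.Sig⁻¹ x.ofLp := hreg.qf_inv_nonneg _
  have h1 := abs_dotProduct_mulVec_le hpsd x.ofLp s.b
  have h2 : |p.lam * (x.ofLp ⬝ᵥ (s.Sig⁻¹ *ᵥ (θ k).ofLp))| ≤
      √p.lam * p.B * √(qf s.Sig⁻¹ x.ofLp) := by
    have h3 : √(qf s.Sig⁻¹ (θ k).ofLp) ≤ p.B / √p.lam := by
      rw [Real.sqrt_le_left (by positivity), div_pow, Real.sq_sqrt hl.le]
      exact (hreg.qf_inv_le hp _).trans (by gcongr)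
    rw [abs_mul, abs_of_pos hl]
    calc p.lam * |x.ofLp ⬝ᵥ (s.Sig⁻¹ *ᵥ (θ k).ofLp)|
        ≤ p.lam * (√(qf s.Sig⁻¹ x.ofLp) * (p.B / √p.lam)) := by
          gcongr
          exact (abs_dotProduct_mulVec_le hpsd _ _).trans (by gcongr)
      _ = (√p.lam * √p.lam) * (√(qf s.Sig⁻¹ x.ofLp) * (p.B / √p.lam)) := by
          rw [Real.mul_self_sqrt hl.le]
      _ = _ := by
          have := Real.sqrt_pos.2 hl
          field_simp
  have h4 : √(k % p.w : ℕ) * √(qf s.Sig (s.Sig⁻¹ *ᵥ x.ofLp) -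
      p.lam * ((s.Sig⁻¹ *ᵥ x.ofLp) ⬝ᵥ (s.Sig⁻¹ *ᵥ x.ofLp))) ≤ √p.w * (p.A / √p.lam) := by
    have hm : (k % p.w : ℕ) ≤ p.w := (Nat.mod_lt k hp.one_le_w).le
    gcongr
    rw [Real.sqrt_le_left (by positivity), div_pow, Real.sq_sqrt hl.le, qf_inv_mulVec hreg.posDef]
    have h5 : 0 ≤ (s.Sig⁻¹ *ᵥ x.ofLp) ⬝ᵥ (s.Sig⁻¹ *ᵥ x.ofLp) := by
      simpa using dotProduct_star_self_nonneg (s.Sig⁻¹ *ᵥ x.ofLp)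
    have h6 : qf s.Sig⁻¹ x.ofLp ≤ p.A ^ 2 / p.lam :=
      (hreg.qf_inv_le hp x).trans (by gcongr)
    have := mul_nonneg hl.le h5
    linarith
  have h7 : winVar p θ k * (p.A / p.alpha) * (√p.w * (p.A / √p.lam)) =
      biasCoeff p * winVar p θ k := by
    have := Real.sqrt_pos.2 hl
    rw [biasCoeff]
    field_simp
  have h8 := hdrift.trans (mul_le_mul_of_nonneg_left h4 (by positivity))
  rw [h7] at h8
  refine (abs_add_le _ _).trans (add_le_add ((abs_sub _ _).trans ?_) h8)
  rw [add_mul]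
  refine add_le_add (h1.trans_eq (mul_comm _ _)) h2

end RestartedOFUL

namespace RestartedOFUL

section Measurability

variable {Ω : Type*} [MeasurableSpace Ω] {d : ℕ}

theorem measurable_det {M : Ω → Matrix (Fin d) (Fin d) ℝ}
    (hM : ∀ i j, Measurable fun ω => M ω i j) : Measurable fun ω => (M ω).det := by
  simp only [Matrix.det_apply']
  exact Finset.measurable_sum _ fun g _ =>
    (Finset.measurable_prod _ fun i _ => hM (g i) i).const_mul _

theorem measurable_inv_apply {M : Ω → Matrix (Fin d) (Fin d) ℝ}
    (hM : ∀ i j, Measurable fun ω => M ω i j) (i j : Fin d) :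
    Measurable fun ω => (M ω)⁻¹ i j := by
  simp only [Matrix.inv_def, Ring.inverse_eq_inv', Matrix.smul_apply, smul_eq_mul,
    Matrix.adjugate_apply]
  refine (measurable_det hM).inv.mul (measurable_det fun k l => ?_)
  simp only [Matrix.updateRow_apply]
  split_ifs
  · exact measurable_const
  · exact hM k l

theorem measurable_dotProduct_mulVec {M : Ω → Matrix (Fin d) (Fin d) ℝ} {v u : Ω → Fin d → ℝ}
    (hM : ∀ i j, Measurable fun ω => M ω i j) (hv : ∀ i, Measurable fun ω => v ω i)
    (hu : ∀ i, Measurable fun ω => u ω i) : Measurable fun ω => v ω ⬝ᵥ (M ω *ᵥ u ω) := by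
  simp only [dotProduct, Matrix.mulVec]
  exact Finset.measurable_sum _ fun i _ => (hv i).mul
    (Finset.measurable_sum _ fun j _ => (hM i j).mul (hu j))

/-- A random state whose entries are random variables. -/
structure MeasurableState (s : Ω → State d) : Prop where
  sig : ∀ i j, Measurable fun ω => (s ω).Sig i j
  b : ∀ i, Measurable fun ω => (s ω).b i

variable {s : Ω → State d} {a : Ω → Vec d} {r σ : Ω → ℝ} {p : Params}

theorem measurable_coord (ha : Measurable a) (i : Fin d) : Measurable fun ω => (a ω).ofLp i := by
  fun_prop

theorem MeasurableState.qf_inv (hs : MeasurableState s) (ha : Measurable a) :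
    Measurable fun ω => qf (s ω).Sig⁻¹ (a ω).ofLp :=
  measurable_dotProduct_mulVec (measurable_inv_apply hs.sig) (measurable_coord ha)
    (measurable_coord ha)

theorem MeasurableState.qf_inv_b (hs : MeasurableState s) :
    Measurable fun ω => qf (s ω).Sig⁻¹ (s ω).b :=
  measurable_dotProduct_mulVec (measurable_inv_apply hs.sig) hs.b hs.b

theorem MeasurableState.cross (hs : MeasurableState s) (ha : Measurable a) :
    Measurable fun ω => (s ω).b ⬝ᵥ ((s ω).Sig⁻¹ *ᵥ (a ω).ofLp) :=
  measurable_dotProduct_mulVec (measurable_inv_apply hs.sig) hs.b (measurable_coord ha)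

theorem MeasurableState.wt (hs : MeasurableState s) (ha : Measurable a) (hσ : Measurable σ) :
    Measurable fun ω => (s ω).wt p (a ω) (σ ω) := by
  unfold State.wt State.sigmaBar ellNorm
  have := hs.qf_inv ha
  unfold qf at this
  fun_prop

theorem MeasurableState.pot (hs : MeasurableState s) (ha : Measurable a) (hσ : Measurable σ) :
    Measurable fun ω => (s ω).pot p (a ω) (σ ω) :=
  (hs.wt ha hσ).mul (hs.qf_inv ha)

theorem MeasurableState.logDet (hs : MeasurableState s) :
    Measurable fun ω => (s ω).logDet p :=
  (measurable_det hs.sig).log.sub_const _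

theorem MeasurableState.update (hs : MeasurableState s) (ha : Measurable a) (hr : Measurable r)
    (hσ : Measurable σ) : MeasurableState fun ω => (s ω).update p (a ω) (r ω) (σ ω) where
  sig i j := by
    simp only [State.update_Sig, Matrix.add_apply, Matrix.smul_apply, Matrix.vecMulVec_apply,
      smul_eq_mul]
    exact (hs.sig i j).add ((hs.wt ha hσ).mul ((measurable_coord ha i).mul (measurable_coord ha j)))
  b i := by
    simp only [State.update_b, Pi.add_apply, Pi.smul_apply, smul_eq_mul]
    exact (hs.b i).add (((hs.wt ha hσ).mul hr).mul (measurable_coord ha i))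

theorem measurableState_state {a : ℕ → Ω → Vec d} {r σ : ℕ → Ω → ℝ} {k : ℕ}
    (ha : ∀ i, 1 ≤ i → i < k → Measurable (a i)) (hr : ∀ i, 1 ≤ i → i < k → Measurable (r i))
    (hσ : ∀ i, 1 ≤ i → i < k → Measurable (σ i)) :
    MeasurableState fun ω => state p (fun i => a i ω) (fun i => r i ω) (fun i => σ i ω) k := by
  induction k using round_induction p with
  | restart k h => simp only [state_restart h]; exact ⟨fun _ _ => measurable_const,
      fun _ => measurable_const⟩
  | step k hk h ih =>
    simp only [state_succ hk h]
    exact (ih (fun i h1 h2 => ha i h1 (by omega)) (fun i h1 h2 => hr i h1 (by omega))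
      (fun i h1 h2 => hσ i h1 (by omega))).update (ha k hk (by omega)) (hr k hk (by omega))
      (hσ k hk (by omega))

end Measurability

section History

variable {Ω : Type*} {d : ℕ} {a : ℕ → Ω → Vec d} {ε : ℕ → Ω → ℝ}

theorem history_mono {i k : ℕ} (h : i ≤ k) : history a ε i ≤ history a ε k :=
  sup_le_sup (biSup_mono fun _ hj => ⟨hj.1, hj.2.trans h⟩)
    (biSup_mono fun _ hj => ⟨hj.1, hj.2.trans_le h⟩)

theorem measurable_arm_history {i k : ℕ} (hi : 1 ≤ i) (h : i ≤ k) :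
    Measurable[history a ε k] (a i) := by
  rw [measurable_iff_comap_le]
  exact (le_biSup (fun i => MeasurableSpace.comap (a i) inferInstance)
    (show i ∈ Set.Icc 1 k from ⟨hi, h⟩)).trans le_sup_left

theorem measurable_noise_history {i k : ℕ} (hi : 1 ≤ i) (h : i < k) :
    Measurable[history a ε k] (ε i) := by
  rw [measurable_iff_comap_le]
  exact (le_biSup (fun i => MeasurableSpace.comap (ε i) inferInstance)
    (show i ∈ Set.Ico 1 k from ⟨hi, h⟩)).trans le_sup_right

theorem history_le [m0 : MeasurableSpace Ω] {K k : ℕ} (ha : ∀ k ∈ Set.Icc 1 K, Measurable (a k))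
    (hε : ∀ k ∈ Set.Icc 1 K, Measurable (ε k)) (hk : k ≤ K) : history a ε k ≤ m0 :=
  sup_le (iSup₂_le fun i hi => (ha i ⟨hi.1, hi.2.trans hk⟩).comap_le)
    (iSup₂_le fun i hi => (hε i ⟨hi.1, hi.2.le.trans hk⟩).comap_le)

/-- The version of the conditional standard deviation that the history determines. -/
noncomputable def condSd [MeasurableSpace Ω] (μ : Measure Ω) (a : ℕ → Ω → Vec d) (ε : ℕ → Ω → ℝ)
    (k : ℕ) (ω : Ω) : ℝ := √((μ[fun ω => ε k ω ^ 2 | history a ε k]) ω)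

theorem measurable_condSd [MeasurableSpace Ω] (μ : Measure Ω) {i k : ℕ} (h : i ≤ k) :
    Measurable[history a ε k] (condSd μ a ε i) := by
  have : Measurable[history a ε i] (condSd μ a ε i) :=
    stronglyMeasurable_condExp.measurable.sqrt
  exact this.mono (history_mono h) le_rfl

end History

theorem integral_mul_eq_of_condExp {Ω : Type*} {m m0 : MeasurableSpace Ω} (hm : m ≤ m0)
    {μ : Measure Ω} [IsProbabilityMeasure μ] {f g h : Ω → ℝ} (hf : Measurable[m] f) {C : ℝ}
    (hC : ∀ ω, |f ω| ≤ C) (hg : Integrable g μ) (hgh : μ[g | m] =ᵐ[μ] h) :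
    ∫ ω, f ω * g ω ∂μ = ∫ ω, f ω * h ω ∂μ := by
  have h1 := condExp_stronglyMeasurable_mul_of_bound hm (μ := μ) hf.stronglyMeasurable hg C
    (.of_forall fun ω => by simpa using hC ω)
  have h2 := integral_condExp (μ := μ) (f := f * g) hm
  change _ = ∫ ω, f ω * g ω ∂μ at h2
  rw [← h2]
  refine integral_congr_ae ?_
  filter_upwards [h1, hgh] with ω h3 h4
  rw [h3, Pi.mul_apply, h4]

end RestartedOFUL

namespace RestartedOFUL

namespace State

variable {d : ℕ} {p : Params} {s : State d} {x : Vec d} {σ τ D : ℝ}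

/-- The coefficient of the noise in the exponent of the supermartingale. -/
noncomputable def linCoeff (p : Params) (τ : ℝ) (s : State d) (x : Vec d) (σ : ℝ) : ℝ :=
  2 * τ * (s.wt p x σ * (s.b ⬝ᵥ (s.Sig⁻¹ *ᵥ x.ofLp))) / (1 + s.pot p x σ)

/-- The coefficient of the squared noise in the bound for the exponential. -/
noncomputable def quadCoeff (p : Params) (τ : ℝ) (s : State d) (x : Vec d) (σ : ℝ) : ℝ :=
  2 * (τ * (s.wt p x σ * s.pot p x σ / (1 + s.pot p x σ))) + 2 * s.linCoeff p τ x σ ^ 2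

theorem Reg.abs_cross_le (hs : s.Reg p) (hD : 0 ≤ D) (hb : qf s.Sig⁻¹ s.b ≤ D ^ 2) :
    |s.b ⬝ᵥ (s.Sig⁻¹ *ᵥ x.ofLp)| ≤ D * √(qf s.Sig⁻¹ x.ofLp) := by
  refine (abs_dotProduct_mulVec_le hs.posDef.inv.posSemidef _ _).trans ?_
  gcongr
  exact Real.sqrt_le_iff.2 ⟨hD, hb⟩

theorem Reg.abs_linCoeff_le (hs : s.Reg p) (hp : p.Valid) (hτ : 0 ≤ τ) (hD : 0 ≤ D)
    (hb : qf s.Sig⁻¹ s.b ≤ D ^ 2) : |s.linCoeff p τ x σ| ≤ 2 * τ * D / p.gamma ^ 2 := by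
  have hu := hs.pot_nonneg (a := x) (σ := σ) hp
  have hw := wt_pos (s := s) (a := x) (σ := σ) hp
  rw [linCoeff, abs_div, abs_of_nonneg (a := 1 + s.pot p x σ) (by positivity), abs_mul (2 * τ),
    abs_mul (s.wt p x σ), abs_of_nonneg (a := 2 * τ) (by positivity), abs_of_pos hw]
  refine (div_le_self (by positivity) (by linarith)).trans ?_
  calc 2 * τ * (s.wt p x σ * |s.b ⬝ᵥ (s.Sig⁻¹ *ᵥ x.ofLp)|)
      ≤ 2 * τ * (s.wt p x σ * (D * √(qf s.Sig⁻¹ x.ofLp))) := by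
        gcongr
        exact hs.abs_cross_le hD hb
    _ = 2 * τ * D * (s.wt p x σ * √(qf s.Sig⁻¹ x.ofLp)) := by ring
    _ ≤ 2 * τ * D * (1 / p.gamma ^ 2) := by
        gcongr
        exact wt_mul_ellNorm_le hp
    _ = _ := by ring

theorem Reg.wt_mul_pot_nonneg (hs : s.Reg p) (hp : p.Valid) :
    0 ≤ s.wt p x σ * s.pot p x σ / (1 + s.pot p x σ) := by
  have hu := hs.pot_nonneg (a := x) (σ := σ) hp
  have hw := wt_pos (s := s) (a := x) (σ := σ) hp
  positivity

theorem Reg.wt_mul_pot_le_gamma (hs : s.Reg p) (hp : p.Valid) :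
    s.wt p x σ * s.pot p x σ / (1 + s.pot p x σ) ≤ (1 / p.gamma ^ 2) ^ 2 := by
  have hu := hs.pot_nonneg (a := x) (σ := σ) hp
  have hw := wt_pos (s := s) (a := x) (σ := σ) hp
  refine (div_le_self (by positivity) (by linarith)).trans ?_
  have h := wt_mul_ellNorm_le (s := s) (a := x) (σ := σ) hp
  have h2 := pow_le_pow_left₀ (by positivity) h 2
  rw [mul_pow, Real.sq_sqrt (hs.qf_inv_nonneg _)] at h2
  rw [pot]
  linarith

theorem Reg.wt_mul_pot_le_alpha (hs : s.Reg p) (hp : p.Valid) :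
    s.wt p x σ * s.pot p x σ / (1 + s.pot p x σ) ≤ 1 / p.alpha ^ 2 := by
  have hu := hs.pot_nonneg (a := x) (σ := σ) hp
  have hw := wt_pos (s := s) (a := x) (σ := σ) hp
  refine le_trans ?_ (wt_le (s := s) (a := x) (σ := σ) hp)
  rw [div_le_iff₀ (by positivity)]
  nlinarith

theorem Reg.quadCoeff_nonneg (hs : s.Reg p) (hp : p.Valid) (hτ : 0 ≤ τ) :
    0 ≤ s.quadCoeff p τ x σ := by
  have := hs.wt_mul_pot_nonneg (x := x) (σ := σ) hp
  unfold quadCoeff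
  positivity

theorem Reg.quadCoeff_le (hs : s.Reg p) (hp : p.Valid) (hτ : 0 ≤ τ) (hD : 0 ≤ D)
    (hb : qf s.Sig⁻¹ s.b ≤ D ^ 2) :
    s.quadCoeff p τ x σ ≤ 2 * (τ * (1 / p.alpha ^ 2)) + 2 * (2 * τ * D / p.gamma ^ 2) ^ 2 := by
  have h1 := hs.wt_mul_pot_le_alpha (x := x) (σ := σ) hp
  have h2 := hs.abs_linCoeff_le (x := x) (σ := σ) hp hτ hD hb
  have h3 := sq_le_sq' (neg_le_of_abs_le h2) (le_of_abs_le h2)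
  unfold quadCoeff
  gcongr

theorem Reg.one_add_quadCoeff_mul_sq_le (hs : s.Reg p) (hp : p.Valid) (hτ : 0 ≤ τ)
    (hσ : 0 ≤ σ) (hb : qf s.Sig⁻¹ s.b ≤ D ^ 2) :
    1 + s.quadCoeff p τ x σ * σ ^ 2 ≤
      Real.exp ((2 * τ + 8 * τ ^ 2 * D ^ 2) * Real.log (1 + s.pot p x σ)) := by
  have hu := hs.pot_nonneg (a := x) (σ := σ) hp
  have hw := wt_pos (s := s) (a := x) (σ := σ) hp
  have h1 := wt_mul_sq_le_one (s := s) (a := x) (σ := σ) hp hσ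
  have h2 : (s.b ⬝ᵥ (s.Sig⁻¹ *ᵥ x.ofLp)) ^ 2 ≤ D ^ 2 * qf s.Sig⁻¹ x.ofLp :=
    (sq_dotProduct_mulVec_le hs.posDef.inv.posSemidef _ _).trans
      (mul_le_mul_of_nonneg_right hb (hs.qf_inv_nonneg _))
  have h3 : s.pot p x σ / (1 + s.pot p x σ) ≤ Real.log (1 + s.pot p x σ) := by
    have := Real.one_sub_inv_le_log_of_pos (x := 1 + s.pot p x σ) (by positivity)
    convert this using 1
    field_simp
    ring
  have hle : s.quadCoeff p τ x σ * σ ^ 2 ≤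
      (2 * τ + 8 * τ ^ 2 * D ^ 2) * (s.pot p x σ / (1 + s.pot p x σ)) := by
    have e : s.quadCoeff p τ x σ * σ ^ 2 = (s.wt p x σ * σ ^ 2) *
        (2 * τ * (s.pot p x σ / (1 + s.pot p x σ)) + 8 * τ ^ 2 *
          (s.wt p x σ * (s.b ⬝ᵥ (s.Sig⁻¹ *ᵥ x.ofLp)) ^ 2) / (1 + s.pot p x σ) ^ 2) := by
      unfold quadCoeff linCoeff
      field_simp
      ring
    have h4 : s.wt p x σ * (s.b ⬝ᵥ (s.Sig⁻¹ *ᵥ x.ofLp)) ^ 2 ≤ D ^ 2 * s.pot p x σ := by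
      rw [pot]
      nlinarith
    rw [e]
    calc _ ≤ 1 * (2 * τ * (s.pot p x σ / (1 + s.pot p x σ)) + 8 * τ ^ 2 *
          (D ^ 2 * s.pot p x σ) / (1 + s.pot p x σ)) := by
          gcongr
          exact le_self_pow₀ (by linarith) two_ne_zero
      _ = _ := by ring
  rw [add_comm]
  refine le_trans ?_ (Real.add_one_le_exp _)
  exact add_le_add_left (hle.trans (by gcongr)) 1

theorem Reg.exp_update_le (hs : s.Reg p) (hp : p.Valid) (hτ : 0 ≤ τ) (hD : 0 ≤ D)
    (hb : qf s.Sig⁻¹ s.b ≤ D ^ 2) {e : ℝ} (he : |e| ≤ p.R)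
    (h1 : τ * (2 * D * (p.R / p.gamma ^ 2) + (p.R / p.gamma ^ 2) ^ 2) ≤ 1)
    (h2 : τ * (p.R / p.gamma ^ 2) ^ 2 ≤ 1 / 2) :
    Real.exp (τ * qf (s.update p x e σ).Sig⁻¹ (s.update p x e σ).b) ≤
      Real.exp (τ * qf s.Sig⁻¹ s.b) *
        (1 + s.linCoeff p τ x σ * e + s.quadCoeff p τ x σ * e ^ 2) := by
  have hstep := qf_inv_rankOne_le hs.posDef (wt_pos (s := s) (a := x) (σ := σ) hp).le x.ofLp s.b e
  rw [← update_Sig e, ← update_b] at hstep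
  change _ ≤ qf s.Sig⁻¹ s.b + _ / (1 + s.pot p x σ) * e +
    s.wt p x σ * s.pot p x σ / (1 + s.pot p x σ) * e ^ 2 at hstep
  set q := s.wt p x σ * s.pot p x σ / (1 + s.pot p x σ) with hq
  set l := s.linCoeff p τ x σ with hl
  have hq0 : 0 ≤ q := hs.wt_mul_pot_nonneg hp
  have hR := hp.R_nonneg
  have he2 : e ^ 2 ≤ p.R ^ 2 := sq_le_sq' (neg_le_of_abs_le he) (le_of_abs_le he)
  have hle : |l * e| ≤ 2 * τ * D * (p.R / p.gamma ^ 2) := by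
    rw [abs_mul]
    calc |l| * |e| ≤ 2 * τ * D / p.gamma ^ 2 * p.R := by
          gcongr
          exact hs.abs_linCoeff_le hp hτ hD hb
      _ = _ := by ring
  have hqe : q * e ^ 2 ≤ (p.R / p.gamma ^ 2) ^ 2 := by
    calc q * e ^ 2 ≤ (1 / p.gamma ^ 2) ^ 2 * p.R ^ 2 := by
          gcongr
          exact hs.wt_mul_pot_le_gamma hp
      _ = _ := by ring
  have hqe0 : 0 ≤ τ * (q * e ^ 2) := by positivity
  have hqe1 : τ * (q * e ^ 2) ≤ τ * (p.R / p.gamma ^ 2) ^ 2 := by gcongr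
  set y := l * e + τ * (q * e ^ 2) with hy
  have hy1 : |y| ≤ 1 := by
    refine (abs_add_le _ _).trans ?_
    rw [abs_of_nonneg hqe0]
    linarith
  have hexp : Real.exp y ≤ 1 + y + y ^ 2 := by
    have := le_of_abs_le (Real.abs_exp_sub_one_sub_id_le hy1)
    linarith
  have hτl : τ * (2 * s.wt p x σ * (s.b ⬝ᵥ (s.Sig⁻¹ *ᵥ x.ofLp)) / (1 + s.pot p x σ) * e) =
      l * e := by
    rw [hl, linCoeff]
    ring
  calc _ ≤ Real.exp (τ * qf s.Sig⁻¹ s.b + y) := by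
        rw [Real.exp_le_exp]
        have := mul_le_mul_of_nonneg_left hstep hτ
        rw [mul_add, mul_add, hτl] at this
        linarith
    _ = Real.exp (τ * qf s.Sig⁻¹ s.b) * Real.exp y := Real.exp_add _ _
    _ ≤ _ := by
        gcongr
        refine hexp.trans ?_
        have : y ^ 2 ≤ 2 * (l * e) ^ 2 + 2 * (τ * (q * e ^ 2)) ^ 2 := by
          nlinarith [sq_nonneg (l * e - τ * (q * e ^ 2))]
        have h5 : (τ * (q * e ^ 2)) ^ 2 ≤ 1 / 2 * (τ * (q * e ^ 2)) := by nlinarith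
        rw [quadCoeff, ← hq, ← hl]
        nlinarith

end State

end RestartedOFUL

namespace RestartedOFUL

/-- Bounded arms and bounded, conditionally centred noise in the rounds `1, …, K`. -/
structure NoiseModel {Ω : Type*} [MeasurableSpace Ω] (μ : Measure Ω) (p : Params) {d : ℕ} (K : ℕ)
    (a : ℕ → Ω → Vec d) (ε : ℕ → Ω → ℝ) : Prop where
  meas_a : ∀ k ∈ Set.Icc 1 K, Measurable (a k)
  meas_noise : ∀ k ∈ Set.Icc 1 K, Measurable (ε k)
  arm_le : ∀ k ∈ Set.Icc 1 K, ∀ ω, ‖a k ω‖ ≤ p.A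
  noise_bdd : ∀ k ∈ Set.Icc 1 K, ∀ᵐ ω ∂μ, |ε k ω| ≤ p.R
  noise_mean : ∀ k ∈ Set.Icc 1 K, μ[ε k | history a ε k] =ᵐ[μ] fun _ => 0

/-- The state driven by the noise instead of the rewards. -/
noncomputable abbrev noiseState {Ω : Type*} [MeasurableSpace Ω] (μ : Measure Ω) (p : Params) {d : ℕ}
    (a : ℕ → Ω → Vec d) (ε : ℕ → Ω → ℝ) (k : ℕ) (ω : Ω) : State d :=
  state p (fun i => a i ω) (fun i => ε i ω) (fun i => condSd μ a ε i ω) k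

/-- The self-normalized noise of round `k`. -/
noncomputable abbrev noiseNorm {Ω : Type*} [MeasurableSpace Ω] (μ : Measure Ω) (p : Params) {d : ℕ}
    (a : ℕ → Ω → Vec d) (ε : ℕ → Ω → ℝ) (k : ℕ) (ω : Ω) : ℝ :=
  noiseSq p (fun i => a i ω) (fun i => ε i ω) (fun i => condSd μ a ε i ω) k

section Maximal

variable {Ω : Type*} [mΩ : MeasurableSpace Ω] {μ : Measure Ω} {p : Params}
  {d : ℕ} {K : ℕ} {a : ℕ → Ω → Vec d} {ε : ℕ → Ω → ℝ}

/-- The event that the self-normalized noise has exceeded `D` in one of the rounds `j₀, …, j`. -/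
def exceed (μ : Measure Ω) (p : Params) (a : ℕ → Ω → Vec d) (ε : ℕ → Ω → ℝ) (D : ℝ) (j₀ j : ℕ) :
    Set Ω := {ω | ∃ i, j₀ ≤ i ∧ i ≤ j ∧ D ^ 2 < noiseNorm μ p a ε i ω}

open Classical in
/-- The exponential process, frozen when the noise exceeds `D`. -/
noncomputable def expProc (μ : Measure Ω) (p : Params) (a : ℕ → Ω → Vec d) (ε : ℕ → Ω → ℝ)
    (D τ c Λ : ℝ) (j₀ j : ℕ) (ω : Ω) : ℝ :=
  if ω ∈ exceed μ p a ε D j₀ j then Real.exp (τ * D ^ 2 - c * Λ)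
  else Real.exp (τ * noiseNorm μ p a ε j ω - c * (noiseState μ p a ε j ω).logDet p)

theorem measurableState_noiseState {i j : ℕ} (h : i ≤ j) :
    @MeasurableState Ω (history a ε j) d (noiseState μ p a ε i) :=
  @measurableState_state Ω (history a ε j) d p a ε (condSd μ a ε) i
    (fun l h1 h2 => measurable_arm_history h1 (by omega))
    (fun l h1 h2 => measurable_noise_history h1 (by omega))
    (fun l h1 h2 => measurable_condSd μ (by omega))

theorem measurable_noiseNorm {i j : ℕ} (h : i ≤ j) :
    Measurable[history a ε j] (noiseNorm μ p a ε i) :=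
  @MeasurableState.qf_inv_b Ω (history a ε j) d _ (measurableState_noiseState h)

theorem measurableSet_exceed {D : ℝ} {j₀ j : ℕ} :
    MeasurableSet[history a ε j] (exceed μ p a ε D j₀ j) := by
  have : exceed μ p a ε D j₀ j =
      ⋃ i ∈ Set.Icc j₀ j, {ω | D ^ 2 < noiseNorm μ p a ε i ω} := by
    ext ω
    simp [exceed, and_assoc]
  rw [this]
  exact MeasurableSet.biUnion (Set.to_countable _) fun i hi =>
    measurable_noiseNorm hi.2 measurableSet_Ioi

theorem measurable_expProc {D τ c Λ : ℝ} {j₀ j : ℕ} :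
    Measurable[history a ε j] (expProc μ p a ε D τ c Λ j₀ j) := by
  refine Measurable.ite (measurableSet_exceed (D := D) (j₀ := j₀)) (@measurable_const ℝ Ω _ (history a ε j) _) ?_
  refine Real.measurable_exp.comp (Measurable.sub (Measurable.const_mul ?_ _)
    (Measurable.const_mul ?_ _))
  · exact measurable_noiseNorm le_rfl
  · exact @MeasurableState.logDet Ω (history a ε j) d _ p (measurableState_noiseState le_rfl)

theorem logDet_nonneg (hp : p.Valid) {a : ℕ → Vec d} {r σ : ℕ → ℝ} (k : ℕ) :
    0 ≤ (state p a r σ k).logDet p := by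
  induction k using round_induction p with
  | restart k h => rw [state_restart h, State.logDet_init]
  | step k hk h ih =>
    rw [state_succ hk h, (reg_state hp k).logDet_update hp]
    have := (reg_state (p := p) (a := a) (r := r) (σ := σ) hp k).pot_nonneg
      (a := a k) (σ := σ k) hp
    have := Real.log_nonneg (x := 1 + (state p a r σ k).pot p (a k) (σ k)) (by linarith)
    linarith

theorem expProc_mem_Icc (hp : p.Valid) {D τ c Λ : ℝ} (hτ : 0 ≤ τ) (hc : 0 ≤ c) (hΛ : 0 ≤ Λ)
    {j₀ j : ℕ} (hj : j₀ ≤ j) (ω : Ω) :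
    expProc μ p a ε D τ c Λ j₀ j ω ∈ Set.Icc 0 (Real.exp (τ * D ^ 2)) := by
  rw [expProc]
  split_ifs with h
  · exact ⟨(Real.exp_pos _).le, Real.exp_le_exp.2 (by linarith [mul_nonneg hc hΛ])⟩
  · have h1 : noiseNorm μ p a ε j ω ≤ D ^ 2 := by
      by_contra! h'
      exact h ⟨j, hj, le_rfl, h'⟩
    refine ⟨(Real.exp_pos _).le, Real.exp_le_exp.2 ?_⟩
    have := mul_nonneg hc (logDet_nonneg hp (a := fun i => a i ω) (r := fun i => ε i ω)
      (σ := fun i => condSd μ a ε i ω) j)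
    have := mul_le_mul_of_nonneg_left h1 hτ
    linarith

theorem NoiseModel.integral_expProc_succ_le [IsProbabilityMeasure μ] (hN : NoiseModel μ p K a ε) (hp : p.Valid)
    {D τ Λ : ℝ} (hD : 0 ≤ D) (hτ : 0 ≤ τ) (hΛ0 : 0 ≤ Λ)
    (h1 : τ * (2 * D * (p.R / p.gamma ^ 2) + (p.R / p.gamma ^ 2) ^ 2) ≤ 1)
    (h2 : τ * (p.R / p.gamma ^ 2) ^ 2 ≤ 1 / 2) {j₀ j : ℕ} (hj : j₀ ≤ j) (hj1 : 1 ≤ j) (hjK : j ≤ K)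
    (hcont : (j + 1) % p.w ≠ 0) (hΛ : ∀ ω, (noiseState μ p a ε (j + 1) ω).logDet p ≤ Λ) :
    ∫ ω, expProc μ p a ε D τ (2 * τ + 8 * τ ^ 2 * D ^ 2) Λ j₀ (j + 1) ω ∂μ ≤
      ∫ ω, expProc μ p a ε D τ (2 * τ + 8 * τ ^ 2 * D ^ 2) Λ j₀ j ω ∂μ := by
  classical
  have hm : history a ε j ≤ mΩ := history_le hN.meas_a hN.meas_noise hjK
  set c := 2 * τ + 8 * τ ^ 2 * D ^ 2 with hc
  have hc0 : 0 ≤ c := by positivity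
  set B := exceed μ p a ε D j₀ j with hB
  have hBm : MeasurableSet[history a ε j] B := measurableSet_exceed
  set s := noiseState μ p a ε j with hs
  set x := a j with hx
  set σ := condSd μ a ε j with hσ
  have hreg (ω : Ω) : (s ω).Reg p := reg_state hp j
  have hsm : @MeasurableState Ω (history a ε j) d s := measurableState_noiseState le_rfl
  have hxm : Measurable[history a ε j] x := measurable_arm_history hj1 le_rfl
  have hσm : Measurable[history a ε j] σ := measurable_condSd μ le_rfl
  have hσ0 (ω : Ω) : 0 ≤ σ ω := Real.sqrt_nonneg _
  set X : Ω → ℝ := fun ω => Real.exp (τ * qf (s ω).Sig⁻¹ (s ω).b - c * (s ω).logDet p -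
    c * Real.log (1 + (s ω).pot p (x ω) (σ ω))) with hX
  set f0 : Ω → ℝ := Bᶜ.indicator X with hf0
  set f1 : Ω → ℝ := Bᶜ.indicator fun ω => X ω * (s ω).linCoeff p τ (x ω) (σ ω) with hf1
  set f2 : Ω → ℝ := Bᶜ.indicator fun ω => X ω * (s ω).quadCoeff p τ (x ω) (σ ω) with hf2
  set fB : Ω → ℝ := B.indicator fun _ => Real.exp (τ * D ^ 2 - c * Λ) with hfB
  have hb {ω : Ω} (hω : ω ∉ B) : qf (s ω).Sig⁻¹ (s ω).b ≤ D ^ 2 := by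
    by_contra! h'
    exact hω ⟨j, hj, le_rfl, h'⟩
  have hXle {ω : Ω} (hω : ω ∉ B) : X ω ≤ Real.exp (τ * D ^ 2) := by
    apply Real.exp_le_exp.2
    have e1 : 0 ≤ c * (s ω).logDet p := mul_nonneg hc0 (logDet_nonneg hp j)
    have e2 : 0 ≤ c * Real.log (1 + (s ω).pot p (x ω) (σ ω)) :=
      mul_nonneg hc0 (Real.log_nonneg (by
        linarith [(hreg ω).pot_nonneg (a := x ω) (σ := σ ω) hp]))
    have e3 := mul_le_mul_of_nonneg_left (hb hω) hτ
    linarith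
  have hwm := @MeasurableState.wt Ω (history a ε j) d s x σ p hsm hxm hσm
  have hpm := @MeasurableState.pot Ω (history a ε j) d s x σ p hsm hxm hσm
  have hcm := @MeasurableState.cross Ω (history a ε j) d s x hsm hxm
  have hXm : Measurable[history a ε j] X :=
    Real.measurable_exp.comp
      ((((@MeasurableState.qf_inv_b Ω (history a ε j) d s hsm).const_mul τ).sub
        ((@MeasurableState.logDet Ω (history a ε j) d s p hsm).const_mul c)).sub
          (((hpm.const_add 1).log).const_mul c))
  have hlm : Measurable[history a ε j] fun ω => (s ω).linCoeff p τ (x ω) (σ ω) :=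
    ((hwm.mul hcm).const_mul (2 * τ)).div (hpm.const_add 1)
  have hqm : Measurable[history a ε j] fun ω => (s ω).quadCoeff p τ (x ω) (σ ω) :=
    (((((hwm.mul hpm).div (hpm.const_add 1)).const_mul τ).const_mul 2)).add
      ((hlm.pow_const 2).const_mul 2)
  have hf0m : Measurable[history a ε j] f0 := hXm.indicator hBm.compl
  have hf1m : Measurable[history a ε j] f1 := (hXm.mul hlm).indicator hBm.compl
  have hf2m : Measurable[history a ε j] f2 := (hXm.mul hqm).indicator hBm.compl
  have hfBm : Measurable[history a ε j] fB :=
    (@measurable_const ℝ Ω _ (history a ε j) _).indicator hBm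
  have hX0 (ω : Ω) : 0 ≤ X ω := (Real.exp_pos _).le
  set C1 := Real.exp (τ * D ^ 2) * (2 * τ * D / p.gamma ^ 2) with hC1
  set C2 := Real.exp (τ * D ^ 2) *
    (2 * (τ * (1 / p.alpha ^ 2)) + 2 * (2 * τ * D / p.gamma ^ 2) ^ 2) with hC2
  have hf0b (ω : Ω) : |f0 ω| ≤ Real.exp (τ * D ^ 2) := by
    by_cases hω : ω ∈ B
    · simp [hf0, hω, Real.exp_nonneg]
    · simp only [hf0, Set.indicator_of_mem (Set.mem_compl hω), abs_of_nonneg (hX0 ω)]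
      exact hXle hω
  have hf1b (ω : Ω) : |f1 ω| ≤ C1 := by
    by_cases hω : ω ∈ B
    · simp only [hf1, Set.indicator_of_notMem (fun h : ω ∈ Bᶜ => h hω), abs_zero]
      positivity
    · simp only [hf1, Set.indicator_of_mem (Set.mem_compl hω), abs_mul, abs_of_nonneg (hX0 ω)]
      exact mul_le_mul (hXle hω) ((hreg ω).abs_linCoeff_le hp hτ hD (hb hω)) (abs_nonneg _)
        (Real.exp_nonneg _)
  have hf2b (ω : Ω) : |f2 ω| ≤ C2 := by
    by_cases hω : ω ∈ B
    · simp only [hf2, Set.indicator_of_notMem (fun h : ω ∈ Bᶜ => h hω), abs_zero]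
      positivity
    · have := (hreg ω).quadCoeff_nonneg (x := x ω) (σ := σ ω) hp hτ
      simp only [hf2, Set.indicator_of_mem (Set.mem_compl hω), abs_mul, abs_of_nonneg (hX0 ω),
        abs_of_nonneg this]
      exact mul_le_mul (hXle hω) ((hreg ω).quadCoeff_le hp hτ hD (hb hω)) this (Real.exp_nonneg _)
  have hεm := hN.meas_noise j ⟨hj1, hjK⟩
  have hεb := hN.noise_bdd j ⟨hj1, hjK⟩
  have hεi : Integrable (ε j) μ :=
    Integrable.of_bound hεm.aestronglyMeasurable p.R (by simpa using hεb)
  have hε2i : Integrable (fun ω => ε j ω ^ 2) μ := by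
    refine Integrable.of_bound (hεm.pow_const 2).aestronglyMeasurable (p.R ^ 2) ?_
    filter_upwards [hεb] with ω hω
    rw [Real.norm_eq_abs, abs_pow]
    gcongr
  have hvar : μ[fun ω => ε j ω ^ 2 | history a ε j] =ᵐ[μ] fun ω => σ ω ^ 2 := by
    have : 0 ≤ᵐ[μ] μ[fun ω => ε j ω ^ 2 | history a ε j] :=
      condExp_nonneg (.of_forall fun ω => sq_nonneg _)
    filter_upwards [this] with ω hω
    exact (Real.sq_sqrt hω).symm
  have hI1 : ∫ ω, f1 ω * ε j ω ∂μ = 0 := by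
    rw [integral_mul_eq_of_condExp hm hf1m hf1b hεi (hN.noise_mean j ⟨hj1, hjK⟩)]
    simp
  have hI2 : ∫ ω, f2 ω * ε j ω ^ 2 ∂μ = ∫ ω, f2 ω * σ ω ^ 2 ∂μ :=
    integral_mul_eq_of_condExp hm hf2m hf2b hε2i hvar
  have hσ2i : Integrable (fun ω => σ ω ^ 2) μ := integrable_condExp.congr hvar
  have bddi {f g : Ω → ℝ} {C : ℝ} (hf : Measurable[history a ε j] f) (hfb : ∀ ω, |f ω| ≤ C)
      (hg : Integrable g μ) : Integrable (fun ω => f ω * g ω) μ :=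
    hg.bdd_mul (hf.mono hm le_rfl).aestronglyMeasurable (.of_forall fun ω => by simpa using hfb ω)
  have hi0 : Integrable f0 μ := Integrable.of_bound (hf0m.mono hm le_rfl).aestronglyMeasurable _
    (.of_forall fun ω => by simpa using hf0b ω)
  have hiB : Integrable fB μ := (integrable_const _).indicator (hm _ hBm)
  have hi1 := bddi hf1m hf1b hεi
  have hi2 := bddi hf2m hf2b hε2i
  have hi3 := bddi hf2m hf2b hσ2i
  have hGi : Integrable (expProc μ p a ε D τ c Λ j₀ j) μ :=
    Integrable.of_bound (measurable_expProc.mono hm le_rfl).aestronglyMeasurable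
      (Real.exp (τ * D ^ 2)) (.of_forall fun ω => by
        have := expProc_mem_Icc (μ := μ) (a := a) (ε := ε) hp hτ hc0 hΛ0 hj (D := D) ω
        rw [Real.norm_eq_abs, abs_of_nonneg this.1]
        exact this.2)
  have hstep : ∀ᵐ ω ∂μ, expProc μ p a ε D τ c Λ j₀ (j + 1) ω ≤
      fB ω + f0 ω + f1 ω * ε j ω + f2 ω * ε j ω ^ 2 := by
    filter_upwards [hεb] with ω hω
    by_cases hωB : ω ∈ B
    · have hB' : ω ∈ exceed μ p a ε D j₀ (j + 1) := by
        obtain ⟨i, hi1, hi2, hi3⟩ := hωB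
        exact ⟨i, hi1, by omega, hi3⟩
      rw [expProc, if_pos hB']
      simp [hfB, hf0, hf1, hf2, hωB]
    · have hup : noiseState μ p a ε (j + 1) ω = (s ω).update p (x ω) (ε j ω) (σ ω) :=
        state_succ hj1 hcont
      have hexp := (hreg ω).exp_update_le (x := x ω) (σ := σ ω) hp hτ hD (hb hωB) hω h1 h2
      have hld := (hreg ω).logDet_update (a := x ω) (σ := σ ω) hp (ε j ω)
      have hnn : noiseNorm μ p a ε (j + 1) ω =
          qf (noiseState μ p a ε (j + 1) ω).Sig⁻¹ (noiseState μ p a ε (j + 1) ω).b := rfl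
      simp only [hfB, hf0, hf1, hf2, Set.indicator_of_mem (Set.mem_compl hωB),
        Set.indicator_of_notMem hωB, zero_add]
      have hmain : Real.exp (τ * noiseNorm μ p a ε (j + 1) ω -
          c * (noiseState μ p a ε (j + 1) ω).logDet p) ≤ X ω +
          X ω * (s ω).linCoeff p τ (x ω) (σ ω) * ε j ω +
          X ω * (s ω).quadCoeff p τ (x ω) (σ ω) * ε j ω ^ 2 := by
        set y := Real.exp (-(c * (s ω).logDet p + c * Real.log (1 + (s ω).pot p (x ω) (σ ω)))) with hy
        have eX : X ω = Real.exp (τ * qf (s ω).Sig⁻¹ (s ω).b) * y := by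
          rw [hX, hy, ← Real.exp_add]
          ring_nf
        rw [hnn, hup, hld, mul_add, sub_eq_add_neg, Real.exp_add, ← hy, eX]
        calc _ ≤ Real.exp (τ * qf (s ω).Sig⁻¹ (s ω).b) * (1 + (s ω).linCoeff p τ (x ω) (σ ω) * ε j ω
              + (s ω).quadCoeff p τ (x ω) (σ ω) * ε j ω ^ 2) * y :=
              mul_le_mul_of_nonneg_right hexp (Real.exp_nonneg _)
          _ = _ := by ring
      refine le_trans ?_ hmain
      rw [expProc]
      split_ifs with hB'
      · obtain ⟨i, hi1, hi2, hi3⟩ := hB'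
        have hij : i = j + 1 := by
          by_contra hne
          exact hωB ⟨i, hi1, by omega, hi3⟩
        subst hij
        apply Real.exp_le_exp.2
        have := mul_le_mul_of_nonneg_left (hΛ ω) hc0
        have := mul_le_mul_of_nonneg_left hi3.le hτ
        linarith
      · exact le_rfl
  have hlast (ω : Ω) : fB ω + f0 ω + f2 ω * σ ω ^ 2 ≤ expProc μ p a ε D τ c Λ j₀ j ω := by
    by_cases hωB : ω ∈ B
    · rw [expProc, if_pos hωB]
      simp [hfB, hf0, hf2, hωB]
    · rw [expProc, if_neg hωB]
      simp only [hfB, hf0, hf2, Set.indicator_of_mem (Set.mem_compl hωB),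
        Set.indicator_of_notMem hωB, zero_add]
      have h3 := (hreg ω).one_add_quadCoeff_mul_sq_le (x := x ω) (σ := σ ω) hp hτ (hσ0 ω) (hb hωB)
      calc X ω + X ω * (s ω).quadCoeff p τ (x ω) (σ ω) * σ ω ^ 2 =
          X ω * (1 + (s ω).quadCoeff p τ (x ω) (σ ω) * σ ω ^ 2) := by ring
        _ ≤ X ω * Real.exp (c * Real.log (1 + (s ω).pot p (x ω) (σ ω))) := by
          have := hX0 ω
          gcongr
        _ = Real.exp (τ * qf (s ω).Sig⁻¹ (s ω).b - c * (s ω).logDet p) := by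
          rw [hX, ← Real.exp_add]
          ring_nf
        _ = _ := rfl
  calc _ ≤ ∫ ω, (fB ω + f0 ω + f1 ω * ε j ω + f2 ω * ε j ω ^ 2) ∂μ :=
        integral_mono_of_nonneg (.of_forall fun ω =>
          (expProc_mem_Icc hp hτ hc0 hΛ0 (by omega) ω).1) (((hiB.add hi0).add hi1).add hi2) hstep
    _ = ∫ ω, (fB ω + f0 ω + f2 ω * σ ω ^ 2) ∂μ := by
        have e1 := integral_add ((hiB.add hi0).add hi1) hi2
        have e2 := integral_add (hiB.add hi0) hi1
        have e3 := integral_add (hiB.add hi0) hi3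
        simp only [Pi.add_apply] at e1 e2 e3
        rw [e1, e2, hI1, hI2, add_zero, ← e3]
    _ ≤ _ := integral_mono ((hiB.add hi0).add hi3) hGi hlast

/-- The self-normalized maximal inequality in one window. -/
theorem NoiseModel.measure_exceed_le [IsProbabilityMeasure μ] (hN : NoiseModel μ p K a ε) (hp : p.Valid)
    {D τ Λ : ℝ} (hD : 0 ≤ D) (hτ : 0 ≤ τ) (hΛ0 : 0 ≤ Λ)
    (h1 : τ * (2 * D * (p.R / p.gamma ^ 2) + (p.R / p.gamma ^ 2) ^ 2) ≤ 1)
    (h2 : τ * (p.R / p.gamma ^ 2) ^ 2 ≤ 1 / 2) {j₀ k : ℕ} (hj₀ : 1 ≤ j₀) (hjk : j₀ ≤ k) (hkK : k ≤ K)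
    (hstart : j₀ ≤ 1 ∨ j₀ % p.w = 0) (hcont : ∀ j, j₀ < j → j ≤ k → j % p.w ≠ 0)
    (hΛ : ∀ j, j₀ < j → j ≤ k → ∀ ω, (noiseState μ p a ε j ω).logDet p ≤ Λ) :
    μ.real {ω | D ^ 2 < noiseNorm μ p a ε k ω} ≤
      Real.exp ((2 * τ + 8 * τ ^ 2 * D ^ 2) * Λ - τ * D ^ 2) := by
  classical
  have hm : history a ε k ≤ mΩ := history_le hN.meas_a hN.meas_noise hkK
  set c := 2 * τ + 8 * τ ^ 2 * D ^ 2 with hc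
  have hc0 : 0 ≤ c := by positivity
  have hint : ∀ j, j₀ ≤ j → j ≤ k → ∫ ω, expProc μ p a ε D τ c Λ j₀ j ω ∂μ ≤ 1 := by
    intro j hj
    induction j, hj using Nat.le_induction with
    | base =>
      intro _
      have hz (ω : Ω) : noiseNorm μ p a ε j₀ ω = 0 := by
        simp [noiseNorm, noiseSq, state_restart hstart, State.init, qf]
      have h0 (ω : Ω) : expProc μ p a ε D τ c Λ j₀ j₀ ω = 1 := by
        have : ω ∉ exceed μ p a ε D j₀ j₀ := by
          rintro ⟨i, hi1, hi2, hi3⟩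
          obtain rfl : i = j₀ := by omega
          rw [hz] at hi3
          exact absurd hi3 (not_lt.2 (sq_nonneg D))
        rw [expProc, if_neg this, hz, noiseState, state_restart hstart, State.logDet_init]
        simp
      simp [h0]
    | succ j hj ih =>
      intro hjk'
      exact (hN.integral_expProc_succ_le hp hD hτ hΛ0 h1 h2 hj (by omega) (by omega)
        (hcont _ (by omega) hjk') (hΛ _ (by omega) hjk')).trans (ih (by omega))
  have hGi : Integrable (expProc μ p a ε D τ c Λ j₀ k) μ :=
    Integrable.of_bound (measurable_expProc.mono hm le_rfl).aestronglyMeasurable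
      (Real.exp (τ * D ^ 2)) (.of_forall fun ω => by
        have := expProc_mem_Icc (μ := μ) (a := a) (ε := ε) hp hτ hc0 hΛ0 hjk (D := D) ω
        rw [Real.norm_eq_abs, abs_of_nonneg this.1]
        exact this.2)
  have hmarkov := mul_meas_ge_le_integral_of_nonneg (.of_forall fun ω =>
    (expProc_mem_Icc (μ := μ) (a := a) (ε := ε) hp hτ hc0 hΛ0 hjk (D := D) ω).1) hGi
    (Real.exp (τ * D ^ 2 - c * Λ))
  have hsub : {ω | D ^ 2 < noiseNorm μ p a ε k ω} ⊆
      {ω | Real.exp (τ * D ^ 2 - c * Λ) ≤ expProc μ p a ε D τ c Λ j₀ k ω} := fun ω hω => by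
    have : ω ∈ exceed μ p a ε D j₀ k := ⟨k, hjk, le_rfl, hω⟩
    rw [Set.mem_ofPred_eq, expProc, if_pos this]
  have h3 := measureReal_mono (μ := μ) hsub
  have h4 := hint k hjk le_rfl
  rw [show c * Λ - τ * D ^ 2 = -(τ * D ^ 2 - c * Λ) by ring, Real.exp_neg, ← one_div,
    le_div_iff₀ (Real.exp_pos _), mul_comm]
  exact ((mul_le_mul_of_nonneg_left h3 (Real.exp_nonneg _)).trans hmarkov).trans h4

end Maximal

end RestartedOFUL

namespace RestartedOFUL

/-- The logarithm of the inverse failure probability after `n` rounds. -/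
noncomputable def confLog (p : Params) (n : ℕ) : ℝ :=
  Real.log (32 * (max (Real.log (p.gamma ^ 2 / p.alpha)) 0 + 1) * (n : ℝ) ^ 2 / p.delta)

/-- The part of the confidence radius that bounds the noise. -/
noncomputable def noiseRadius (p : Params) (d n : ℕ) : ℝ :=
  12 * √(d * Real.log (1 + n * p.A ^ 2 / (p.alpha ^ 2 * d * p.lam)) * confLog p n) +
    30 * confLog p n * (p.R / p.gamma ^ 2)

theorem radius_eq (p : Params) (d n : ℕ) :
    radius p d n = noiseRadius p d n + √p.lam * p.B := rfl

variable {p : Params} {d : ℕ}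

theorem le_confLog_arg (hp : p.Valid) (n : ℕ) : 32 * (n : ℝ) ^ 2 / p.delta ≤
    32 * (max (Real.log (p.gamma ^ 2 / p.alpha)) 0 + 1) * (n : ℝ) ^ 2 / p.delta := by
  have := hp.delta_pos
  have := le_max_right (Real.log (p.gamma ^ 2 / p.alpha)) 0
  gcongr
  linarith

theorem exp_neg_confLog_le (hp : p.Valid) {n : ℕ} (hn : 1 ≤ n) :
    Real.exp (-confLog p n) ≤ p.delta / 32 * (1 / (n : ℝ) ^ 2) := by
  have hδ := hp.delta_pos
  have hn0 : (0 : ℝ) < n := by exact_mod_cast hn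
  have h := le_confLog_arg hp n
  have h0 : 0 < 32 * (n : ℝ) ^ 2 / p.delta := by positivity
  rw [Real.exp_neg, confLog, Real.exp_log (h0.trans_le h)]
  refine (inv_anti₀ h0 h).trans_eq ?_
  field_simp

theorem one_le_confLog (hp : p.Valid) {n : ℕ} (hn : 1 ≤ n) : 1 ≤ confLog p n := by
  have hδ := hp.delta_pos
  have hn0 : (1 : ℝ) ≤ (n : ℝ) ^ 2 := by exact_mod_cast Nat.one_le_pow 2 n hn
  have h := le_confLog_arg hp n
  have h1 : 32 ≤ 32 * (n : ℝ) ^ 2 / p.delta := by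
    rw [le_div_iff₀ hδ]
    nlinarith [hp.delta_lt_one]
  rw [confLog, Real.le_log_iff_exp_le (by linarith)]
  linarith [Real.exp_one_lt_d9]

theorem windowLog_nonneg (hp : p.Valid) (n : ℕ) :
    0 ≤ d * Real.log (1 + n * p.A ^ 2 / (p.alpha ^ 2 * d * p.lam)) := by
  have := hp.lam_pos
  exact mul_nonneg (by positivity) (Real.log_nonneg (le_add_of_nonneg_right (by positivity)))

theorem noiseRadius_nonneg (hp : p.Valid) {n : ℕ} (hn : 1 ≤ n) : 0 ≤ noiseRadius p d n := by
  have h1 := one_le_confLog hp hn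
  have := hp.R_nonneg
  unfold noiseRadius
  positivity

theorem noiseRadius_mono (hp : p.Valid) {n m : ℕ} (hn : 1 ≤ n) (h : n ≤ m) :
    noiseRadius p d n ≤ noiseRadius p d m := by
  have h1 := one_le_confLog hp hn
  have hl := hp.lam_pos
  have hR := hp.R_nonneg
  have hδ := hp.delta_pos
  have hn0 : (0 : ℝ) < n := by exact_mod_cast hn
  have hmax := le_max_right (Real.log (p.gamma ^ 2 / p.alpha)) 0
  have h2 : confLog p n ≤ confLog p m := by
    unfold confLog
    gcongr
  have h3 := windowLog_nonneg (d := d) hp m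
  unfold noiseRadius
  gcongr

theorem betaHat_le_betaMax (hp : p.Valid) (k : ℕ) : betaHat p d k ≤ betaMax p d := by
  rw [betaMax, radius_eq]
  unfold betaHat
  split_ifs with h
  · linarith [noiseRadius_nonneg (d := d) hp hp.one_le_w]
  · rw [radius_eq]
    have := noiseRadius_mono (d := d) hp (n := k % p.w) (m := p.w) (by omega)
      (Nat.mod_lt k hp.one_le_w).le
    linarith

theorem sqrt_lam_mul_le_betaMax (hp : p.Valid) : √p.lam * p.B ≤ betaMax p d := by
  rw [betaMax, radius_eq]
  linarith [noiseRadius_nonneg (d := d) hp hp.one_le_w]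

theorem exists_window_start (w : ℕ) {k : ℕ} (hk : 1 ≤ k) : ∃ j₀, 1 ≤ j₀ ∧ j₀ ≤ k ∧
    (j₀ ≤ 1 ∨ j₀ % w = 0) ∧ ∀ j, j₀ < j → j ≤ k → j % w ≠ 0 ∧ j % w ≤ k % w := by
  induction k, hk using Nat.le_induction with
  | base => exact ⟨1, le_rfl, le_rfl, by simp, fun j h1 h2 => by omega⟩
  | succ k hk ih =>
    by_cases h : (k + 1) % w = 0
    · exact ⟨k + 1, by omega, le_rfl, .inr h, fun j h1 h2 => by omega⟩
    · obtain ⟨j₀, h1, h2, h3, h4⟩ := ih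
      refine ⟨j₀, h1, by omega, h3, fun j h5 h6 => ?_⟩
      rcases h6.eq_or_lt with rfl | h6
      · exact ⟨h, le_rfl⟩
      · have := h4 j h5 (by omega)
        rw [succ_mod_of_ne h]
        omega

theorem noiseSq_restart {a : ℕ → Vec d} {ε σ : ℕ → ℝ} {k : ℕ} (h : k ≤ 1 ∨ k % p.w = 0) :
    noiseSq p a ε σ k = 0 := by
  simp [noiseSq, state_restart h, State.init, qf]

theorem noiseSq_eq_zero {a : ℕ → Vec d} {ε σ : ℕ → ℝ} {k : ℕ}
    (ha : ∀ i, 1 ≤ i → i < k → a i = 0) : noiseSq p a ε σ k = 0 := by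
  have : (state p a ε σ k).b = 0 := by
    induction k using round_induction p with
    | restart k h => rw [state_restart h]; rfl
    | step k hk h ih =>
      rw [state_succ hk h, State.update_b, ih fun i h1 h2 => ha i h1 (by omega),
        ha k hk (by omega)]
      simp
  simp [noiseSq, this, qf]

section

variable {Ω : Type*} [mΩ : MeasurableSpace Ω] {μ : Measure Ω}
  {K : ℕ} {a : ℕ → Ω → Vec d} {ε : ℕ → Ω → ℝ}

/-- The event that the confidence bound of round `k` fails. -/
def badRound (μ : Measure Ω) (p : Params) (a : ℕ → Ω → Vec d) (ε : ℕ → Ω → ℝ) (k : ℕ) : Set Ω :=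
  {ω | noiseRadius p d (k % p.w) ^ 2 < noiseNorm μ p a ε k ω}

theorem badRound_restart {k : ℕ} (h : k ≤ 1 ∨ k % p.w = 0) : badRound μ p a ε k = ∅ := by
  ext ω
  simp only [badRound, noiseNorm, noiseSq_restart h, Set.mem_ofPred_eq, Set.mem_empty_iff_false,
    iff_false, not_lt]
  positivity

theorem sqrt_noiseSq_add_le (hp : p.Valid) {k : ℕ} {ω : Ω} (h : ω ∉ badRound μ p a ε k) :
    √(noiseNorm μ p a ε k ω) + √p.lam * p.B ≤ betaHat p d k := by
  unfold betaHat
  split_ifs with hk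
  · have : k ≤ 1 ∨ k % p.w = 0 := by omega
    simp [noiseNorm, noiseSq_restart this]
  · rw [radius_eq]
    have h1 := noiseRadius_nonneg (d := d) hp (n := k % p.w) (by omega)
    have h2 := Real.sqrt_le_iff.2 ⟨h1, not_lt.1 h⟩
    linarith

theorem NoiseModel.measurableSet_badRound (hN : NoiseModel μ p K a ε) {k : ℕ} (hk : k ≤ K) :
    MeasurableSet (badRound μ p a ε k) :=
  history_le hN.meas_a hN.meas_noise hk _
    (measurable_noiseNorm (μ := μ) (p := p) le_rfl measurableSet_Ioi)

theorem NoiseModel.measure_badRound_le [IsProbabilityMeasure μ] (hN : NoiseModel μ p K a ε) (hp : p.Valid) (hd : 1 ≤ d)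
    {k : ℕ} (hk : k ∈ Set.Icc 1 K) :
    μ.real (badRound μ p a ε k) ≤ p.delta / 32 * (1 / ((k % p.w : ℕ) : ℝ) ^ 2) := by
  have hδ := hp.delta_pos
  have hrhs : 0 ≤ p.delta / 32 * (1 / ((k % p.w : ℕ) : ℝ) ^ 2) := by positivity
  by_cases h : k ≤ 1 ∨ k % p.w = 0
  · simpa [badRound_restart h] using hrhs
  rcases hp.A_nonneg.eq_or_lt with hA | hA
  · have : badRound μ p a ε k = ∅ := by
      ext ω
      have h0 : noiseNorm μ p a ε k ω = 0 := noiseSq_eq_zero fun i h1 h2 => by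
        have := hN.arm_le i ⟨h1, h2.le.trans hk.2⟩ ω
        rw [← hA] at this
        simpa using this
      simp only [badRound, h0, Set.mem_ofPred_eq, Set.mem_empty_iff_false, iff_false, not_lt]
      positivity
    simpa [this] using hrhs
  set n := k % p.w with hn
  have hn1 : 1 ≤ n := by omega
  refine le_trans ?_ (exp_neg_confLog_le hp hn1)
  obtain ⟨j₀, hj1, hjk, hstart, hcont⟩ := exists_window_start p.w hk.1
  set l := confLog p n with hl
  have hl1 : 1 ≤ l := one_le_confLog hp hn1
  set Λ := d * Real.log (1 + n * p.A ^ 2 / (p.alpha ^ 2 * d * p.lam)) with hΛ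
  have hd0 : (0 : ℝ) < d := by exact_mod_cast hd
  have hn0 : (0 : ℝ) < n := by exact_mod_cast hn1
  have hlam := hp.lam_pos
  have hal := hp.alpha_pos
  have hΛ0 : 0 < Λ := mul_pos hd0 (Real.log_pos (lt_add_of_pos_right _ (by positivity)))
  set E := p.R / p.gamma ^ 2 with hE
  have hE0 : 0 ≤ E := div_nonneg hp.R_nonneg (sq_nonneg _)
  set D := noiseRadius p d n with hD
  have hDdef : D = 12 * √(Λ * l) + 30 * l * E := rfl
  have hs := Real.sqrt_pos.2 (show 0 < Λ * l by positivity)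
  have hD0 : 0 < D := by rw [hDdef]; positivity
  have hDE : 30 * (l * E) ≤ D := by rw [hDdef]; linarith
  have hDE' : 30 * E ≤ D := by nlinarith
  have hDΛ : 144 * (Λ * l) ≤ D ^ 2 := by
    have h1 : 12 * √(Λ * l) ≤ D := by
      rw [hDdef]
      have : 0 ≤ 30 * l * E := by positivity
      linarith
    have h2 := pow_le_pow_left₀ (by positivity) h1 2
    rw [mul_pow, Real.sq_sqrt (by positivity)] at h2
    linarith
  have key := hN.measure_exceed_le hp (D := D) (τ := 2 * l / D ^ 2) (Λ := Λ) hD0.le (by positivity)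
    hΛ0.le ?_ ?_ hj1 hjk hk.2 hstart (fun j h1 h2 => (hcont j h1 h2).1) ?_
  · refine key.trans (Real.exp_le_exp.2 ?_)
    have e : (2 * (2 * l / D ^ 2) + 8 * (2 * l / D ^ 2) ^ 2 * D ^ 2) * Λ - 2 * l / D ^ 2 * D ^ 2 =
        (4 * l + 32 * l ^ 2) * Λ / D ^ 2 - 2 * l := by
      field_simp
      ring
    rw [e]
    have : (4 * l + 32 * l ^ 2) * Λ / D ^ 2 ≤ l := by
      rw [div_le_iff₀ (by positivity)]
      have h1 : l * Λ ≤ l ^ 2 * Λ := by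
        have : l ≤ l ^ 2 := by nlinarith
        gcongr
      have h2 := mul_le_mul_of_nonneg_left hDΛ (by linarith : 0 ≤ l)
      have h3 : 0 ≤ l ^ 2 * Λ := by positivity
      nlinarith
    linarith
  · rw [div_mul_eq_mul_div, div_le_one (by positivity)]
    have h1 : l * E * D ≤ D / 30 * D := by gcongr; linarith
    have h2 : l * E * E ≤ D / 30 * (D / 30) := by gcongr <;> linarith
    nlinarith [sq_nonneg D]
  · rw [div_mul_eq_mul_div, div_le_iff₀ (by positivity)]
    have h2 : l * E * E ≤ D / 30 * (D / 30) := by gcongr <;> linarith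
    nlinarith [sq_nonneg D]
  · intro j h1 h2 ω
    refine (logDet_state_le hp hd fun i hi1 hi2 => hN.arm_le i ⟨hi1, ?_⟩ ω).trans ?_
    · have := hk.2
      omega
    · have : j % p.w ≤ n := (hcont j h1 h2).2
      rw [hΛ]
      gcongr

theorem sum_inv_sq_mod_le (p : Params) (K : ℕ) :
    ∑ k ∈ Finset.Icc 1 K, 1 / ((k % p.w : ℕ) : ℝ) ^ 2 ≤ 2 * (((K / p.w : ℕ) : ℝ) + 1) := by
  have key : ∑ k ∈ Finset.Icc 1 K, 1 / ((k % p.w : ℕ) : ℝ) ^ 2 ≤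
      2 * ((K / p.w : ℕ) : ℝ) + (2 - 2 / (((K % p.w : ℕ) : ℝ) + 1)) := by
    induction K with
    | zero => simp
    | succ k ih =>
      rw [Finset.sum_Icc_succ_top (by omega)]
      by_cases h : (k + 1) % p.w = 0
      · have h0 : (0 : ℝ) ≤ 2 / (((k % p.w : ℕ) : ℝ) + 1) := by positivity
        have e1 : (1 : ℝ) / 0 ^ 2 = 0 := by simp
        have e2 : (2 : ℝ) - 2 / (0 + 1) = 0 := by norm_num
        rw [h, succ_div_of_eq h, Nat.cast_zero, Nat.cast_succ, e1, e2]
        linarith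
      · rw [succ_div_of_ne h, succ_mod_of_ne h]
        push_cast
        set n : ℝ := ((k % p.w : ℕ) : ℝ) with hn
        have hn0 : 0 ≤ n := by positivity
        have : 1 / (n + 1) ^ 2 ≤ 2 / (n + 1) - 2 / (n + 1 + 1) := by
          rw [div_sub_div _ _ (by positivity) (by positivity),
            div_le_div_iff₀ (by positivity) (by positivity)]
          nlinarith
        linarith
  have : (0 : ℝ) ≤ 2 / (((K % p.w : ℕ) : ℝ) + 1) := by positivity
  linarith

open Classical in
/-- The rounds whose confidence bound fails. -/
noncomputable def badRounds (μ : Measure Ω) (p : Params) (K : ℕ) (a : ℕ → Ω → Vec d)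
    (ε : ℕ → Ω → ℝ) (ω : Ω) : Finset ℕ := {k ∈ Finset.Icc 1 K | ω ∈ badRound μ p a ε k}

theorem NoiseModel.measure_card_badRounds [IsProbabilityMeasure μ] (hN : NoiseModel μ p K a ε) (hp : p.Valid) (hd : 1 ≤ d)
    {t : ℝ} (ht : (((K / p.w : ℕ) : ℝ) + 1) / 16 ≤ t) :
    MeasurableSet {ω | ((badRounds μ p K a ε ω).card : ℝ) < t} ∧
      1 - p.delta ≤ μ.real {ω | ((badRounds μ p K a ε ω).card : ℝ) < t} := by
  classical
  have ht0 : 0 < t := lt_of_lt_of_le (by positivity) ht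
  set f : Ω → ℝ := fun ω => ∑ k ∈ Finset.Icc 1 K, (badRound μ p a ε k).indicator 1 ω with hf
  have hcard (ω : Ω) : ((badRounds μ p K a ε ω).card : ℝ) = f ω := by
    rw [badRounds, Finset.card_filter]
    push_cast
    exact Finset.sum_congr rfl fun k _ => by simp [Set.indicator_apply]
  have hms {k : ℕ} (hk : k ∈ Finset.Icc 1 K) : MeasurableSet (badRound μ p a ε k) :=
    hN.measurableSet_badRound (Finset.mem_Icc.1 hk).2
  have hfm : Measurable f := Finset.measurable_sum _ fun k hk =>
    measurable_const.indicator (hms hk)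
  have hi {k : ℕ} (hk : k ∈ Finset.Icc 1 K) :
      Integrable ((badRound μ p a ε k).indicator (1 : Ω → ℝ)) μ :=
    (integrable_const (1 : ℝ)).indicator (hms hk)
  have hint : ∫ ω, f ω ∂μ ≤ p.delta * ((((K / p.w : ℕ) : ℝ) + 1) / 16) := by
    rw [hf, integral_finsetSum _ fun k hk => hi hk]
    calc ∑ k ∈ Finset.Icc 1 K, ∫ ω, (badRound μ p a ε k).indicator 1 ω ∂μ
        = ∑ k ∈ Finset.Icc 1 K, μ.real (badRound μ p a ε k) :=
          Finset.sum_congr rfl fun k hk => integral_indicator_one (hms hk)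
      _ ≤ ∑ k ∈ Finset.Icc 1 K, p.delta / 32 * (1 / ((k % p.w : ℕ) : ℝ) ^ 2) :=
          Finset.sum_le_sum fun k hk => hN.measure_badRound_le hp hd (Finset.mem_Icc.1 hk)
      _ = p.delta / 32 * ∑ k ∈ Finset.Icc 1 K, 1 / ((k % p.w : ℕ) : ℝ) ^ 2 :=
          (Finset.mul_sum _ _ _).symm
      _ ≤ p.delta / 32 * (2 * (((K / p.w : ℕ) : ℝ) + 1)) := by
          have := hp.delta_pos
          gcongr
          exact sum_inv_sq_mod_le p K
      _ = _ := by ring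
  have hmarkov := mul_meas_ge_le_integral_of_nonneg (μ := μ) (f := f)
    (.of_forall fun ω => Finset.sum_nonneg fun k _ => Set.indicator_nonneg (by simp) ω)
    (integrable_finsetSum _ fun k hk => hi hk) t
  have hset : {ω | ((badRounds μ p K a ε ω).card : ℝ) < t} = {ω | t ≤ f ω}ᶜ := by
    ext ω
    simp [hcard]
  have hm : MeasurableSet {ω | t ≤ f ω} := measurableSet_le measurable_const hfm
  rw [hset, probReal_compl_eq_one_sub hm]
  refine ⟨hm.compl, ?_⟩
  have h1 : t * μ.real {ω | t ≤ f ω} ≤ t * p.delta := by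
    refine (hmarkov.trans hint).trans ?_
    rw [mul_comm t]
    exact mul_le_mul_of_nonneg_left ht hp.delta_pos.le
  linarith [le_of_mul_le_mul_left h1 ht0]

end

end RestartedOFUL

namespace RestartedOFUL

variable {p : Params} {d : ℕ}

theorem le_two_mul_log {u : ℝ} (hu : 0 ≤ u) (h : Real.log (1 + u) ≤ 1) :
    u ≤ 2 * Real.log (1 + u) := by
  have h0 : 0 ≤ Real.log (1 + u) := Real.log_nonneg (by linarith)
  have h1 := le_of_abs_le (Real.abs_exp_sub_one_sub_id_le (by rwa [abs_of_nonneg h0]))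
  rw [Real.exp_log (by linarith)] at h1
  nlinarith

theorem div_one_add_le_log {u : ℝ} (hu : 0 ≤ u) : u / (1 + u) ≤ Real.log (1 + u) := by
  have := Real.one_sub_inv_le_log_of_pos (x := 1 + u) (by positivity)
  convert this using 1
  field_simp
  ring

/-- The width of a round is paid for by the potential and, through the Cauchy-Schwarz inequality,
by the variance. -/
theorem min_width_le {s : State d} (hs : s.Reg p) (hp : p.Valid) (x : Vec d) {σ β : ℝ}
    (hβ : 0 ≤ β) : min 2 (2 * β * ellNorm s.Sig⁻¹ x) ≤
      2 * (1 + β * p.gamma ^ 2) * Real.log (1 + s.pot p x σ) +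
      2 * √2 * β * (√(σ ^ 2 + p.alpha ^ 2) * √(Real.log (1 + s.pot p x σ))) := by
  have hu := hs.pot_nonneg (a := x) (σ := σ) hp
  have hbar := State.sigmaBar_pos (s := s) (a := x) (σ := σ) hp
  have hg := hp.gamma_pos
  have hal := hp.alpha_pos
  set E := ellNorm s.Sig⁻¹ x with hE
  have hE0 : 0 ≤ E := Real.sqrt_nonneg _
  have hE2 : E ^ 2 = qf s.Sig⁻¹ x.ofLp := Real.sq_sqrt (hs.qf_inv_nonneg _)
  have hpot : s.pot p x σ * s.sigmaBar p x σ ^ 2 = E ^ 2 := by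
    rw [State.pot, State.wt, hE2]
    field_simp
  set u := s.pot p x σ with hu'
  set t := Real.log (1 + u) with ht
  have ht0 : 0 ≤ t := Real.log_nonneg (by linarith)
  set g := β * p.gamma ^ 2 with hg'
  have hg0 : 0 ≤ g := by positivity
  have hlast : 0 ≤ 2 * √2 * β * (√(σ ^ 2 + p.alpha ^ 2) * √t) := by positivity
  rcases le_total (max σ p.alpha) (p.gamma * √E) with h | h
  · have hsb : s.sigmaBar p x σ = p.gamma * √E := max_eq_right h
    rw [hsb] at hpot hbar
    rw [mul_pow, Real.sq_sqrt hE0] at hpot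
    have hEpos : 0 < E := Real.sqrt_pos.1 (pos_of_mul_pos_right hbar hg.le)
    have hEu : E = p.gamma ^ 2 * u := by
      have : E * E = E * (p.gamma ^ 2 * u) := by linarith
      exact mul_left_cancel₀ hEpos.ne' this
    have e : 2 * β * E = 2 * (g * u) := by rw [hEu]; ring
    rw [e]
    have h1 : (1 + g) * (u / (1 + u)) ≤ (1 + g) * t := by
      gcongr
      exact div_one_add_le_log hu
    have h2 : min 1 (g * u) ≤ (1 + g) * (u / (1 + u)) := by
      rw [mul_div_assoc', le_div_iff₀ (by positivity)]
      rcases le_total (g * u) 1 with h3 | h3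
      · rw [min_eq_right h3]
        nlinarith
      · rw [min_eq_left h3]
        nlinarith
    have h3 : min 2 (2 * (g * u)) = 2 * min 1 (g * u) := by
      rw [mul_min_of_nonneg _ _ zero_le_two, mul_one]
    rw [h3]
    linarith
  · have hsb : s.sigmaBar p x σ = max σ p.alpha := max_eq_left h
    rcases le_total 1 t with h1 | h1
    · refine (min_le_left _ _).trans ?_
      have : 2 ≤ 2 * (1 + g) * t := by nlinarith
      linarith
    · refine (min_le_right _ _).trans ?_
      have h2 : s.sigmaBar p x σ ^ 2 ≤ σ ^ 2 + p.alpha ^ 2 := by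
        rw [hsb]
        rcases max_choice σ p.alpha with h3 | h3 <;> rw [h3] <;> nlinarith
      have h3 : E ≤ √2 * (√(σ ^ 2 + p.alpha ^ 2) * √t) := by
        rw [← Real.sqrt_mul (by positivity), ← Real.sqrt_mul (by positivity)]
        apply Real.le_sqrt_of_sq_le
        rw [← hpot]
        calc u * s.sigmaBar p x σ ^ 2 ≤ 2 * t * (σ ^ 2 + p.alpha ^ 2) := by
              gcongr
              exact le_two_mul_log hu h1
          _ = _ := by ring
      have h4 : 0 ≤ 2 * (1 + g) * t := by positivity
      have h5 := mul_le_mul_of_nonneg_left h3 (show 0 ≤ 2 * β by positivity)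
      linarith

/-- What a trajectory of the algorithm satisfies in the rounds `1, …, K`. -/
structure IsTrajectory (p : Params) {d : ℕ} (K : ℕ) (θ a aStar : ℕ → Vec d) (ε σ : ℕ → ℝ) :
    Prop where
  theta_le : ∀ k ∈ Set.Icc 1 K, ‖θ k‖ ≤ p.B
  arm_le : ∀ k ∈ Set.Icc 1 K, ‖a k‖ ≤ p.A
  opt_le : ∀ k ∈ Set.Icc 1 K, ‖aStar k‖ ≤ p.A
  mean_arm : ∀ k ∈ Set.Icc 1 K, inner ℝ (a k) (θ k) ∈ Set.Icc (-1 : ℝ) 1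
  mean_opt : ∀ k ∈ Set.Icc 1 K, inner ℝ (aStar k) (θ k) ∈ Set.Icc (-1 : ℝ) 1
  play_max : ∀ k ∈ Set.Icc 1 K,
    (state p a (reward θ a ε) σ k).ucb (betaHat p d k) (aStar k) ≤
      (state p a (reward θ a ε) σ k).ucb (betaHat p d k) (a k)

namespace IsTrajectory

variable {K : ℕ} {θ a aStar : ℕ → Vec d} {ε σ : ℕ → ℝ}

theorem roundRegret_le (h : IsTrajectory p K θ a aStar ε σ) {k : ℕ} (hk : k ∈ Set.Icc 1 K) :
    inner ℝ (aStar k) (θ k) - inner ℝ (a k) (θ k) ≤ 2 * min 1 (p.A * p.B) := by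
  have hA : 0 ≤ p.A := (norm_nonneg _).trans (h.arm_le k hk)
  have h1 := (h.mean_arm k hk).1
  have h2 := (h.mean_opt k hk).2
  have h3 : |inner ℝ (aStar k) (θ k)| ≤ p.A * p.B := (abs_real_inner_le_norm _ _).trans
    (mul_le_mul (h.opt_le k hk) (h.theta_le k hk) (norm_nonneg _) hA)
  have h4 : |inner ℝ (a k) (θ k)| ≤ p.A * p.B := (abs_real_inner_le_norm _ _).trans
    (mul_le_mul (h.arm_le k hk) (h.theta_le k hk) (norm_nonneg _) hA)
  rw [abs_le] at h3 h4
  rcases min_choice 1 (p.A * p.B) with h5 | h5 <;> rw [h5] <;> linarith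

theorem roundRegret_le_of_good (h : IsTrajectory p K θ a aStar ε σ) (hp : p.Valid) {k : ℕ}
    (hk : k ∈ Set.Icc 1 K) (hgood : √(noiseSq p a ε σ k) + √p.lam * p.B ≤ betaHat p d k) :
    inner ℝ (aStar k) (θ k) - inner ℝ (a k) (θ k) ≤
      min 2 (2 * betaMax p d * ellNorm (state p a (reward θ a ε) σ k).Sig⁻¹ (a k)) +
        2 * (biasCoeff p * winVar p θ k) := by
  have ha : ∀ i, 1 ≤ i → i < k → ‖a i‖ ≤ p.A := fun i h1 h2 => h.arm_le i ⟨h1, h2.le.trans hk.2⟩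
  have h1 := abs_estimate_sub_le (ε := ε) (σ := σ) hp ha (h.theta_le k hk) (h.opt_le k hk)
  have h2 := abs_estimate_sub_le (ε := ε) (σ := σ) hp ha (h.theta_le k hk) (h.arm_le k hk)
  have h3 := h.play_max k hk
  unfold State.ucb at h3
  set s := state p a (reward θ a ε) σ k
  have h4 : 0 ≤ ellNorm s.Sig⁻¹ (aStar k) := Real.sqrt_nonneg _
  have h5 : 0 ≤ ellNorm s.Sig⁻¹ (a k) := Real.sqrt_nonneg _
  have h6 := mul_le_mul_of_nonneg_right hgood h4
  have h7 := mul_le_mul_of_nonneg_right hgood h5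
  have h8 := mul_le_mul_of_nonneg_right (betaHat_le_betaMax (d := d) hp k) h5
  have hbias : 0 ≤ biasCoeff p * winVar p θ k := by
    have := winVar_nonneg (p := p) (θ := θ) k
    have := hp.alpha_pos
    unfold biasCoeff
    positivity
  rw [abs_le] at h1 h2
  rcases min_choice 2 (2 * betaMax p d * ellNorm s.Sig⁻¹ (a k)) with h9 | h9 <;> rw [h9]
  · linarith [(h.mean_arm k hk).1, (h.mean_opt k hk).2]
  · linarith [h1.1, h2.2]

theorem regret_le (h : IsTrajectory p K θ a aStar ε σ) (hp : p.Valid) (hd : 1 ≤ d) (hK : 1 ≤ K)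
    {BK VK : ℝ} (hBK : ∑ k ∈ Finset.Ico 1 K, ‖θ (k + 1) - θ k‖ ≤ BK)
    (hVK : ∑ k ∈ Finset.Icc 1 K, σ k ^ 2 ≤ VK) {bad : Finset ℕ}
    (hgood : ∀ k ∈ Set.Icc 1 K, k ∉ bad →
      √(noiseSq p a ε σ k) + √p.lam * p.B ≤ betaHat p d k) :
    regret K θ aStar a ≤ 2 * biasCoeff p * (p.w * BK) +
      2 * (1 + betaMax p d * p.gamma ^ 2) * ((((K / p.w : ℕ) : ℝ) + 1) * (d * iota p d)) +
      2 * √2 * betaMax p d * (√(VK + K * p.alpha ^ 2) *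
        √((((K / p.w : ℕ) : ℝ) + 1) * (d * iota p d))) +
      2 * min 1 (p.A * p.B) * bad.card := by
  classical
  set s := state p a (reward θ a ε) σ with hs
  set β := betaMax p d with hβ
  have hβ0 : 0 ≤ β := (mul_nonneg (Real.sqrt_nonneg _) hp.B_nonneg).trans
    (sqrt_lam_mul_le_betaMax hp)
  have hg0 : 0 ≤ β * p.gamma ^ 2 := by positivity
  have hAB : 0 ≤ min 1 (p.A * p.B) := le_min zero_le_one (mul_nonneg hp.A_nonneg hp.B_nonneg)
  set t : ℕ → ℝ := fun k => Real.log (1 + (s k).pot p (a k) (σ k)) with ht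
  have ht0 (k : ℕ) : 0 ≤ t k :=
    have := (reg_state (p := p) (a := a) (r := reward θ a ε) (σ := σ) hp k).pot_nonneg
      (a := a k) (σ := σ k) hp
    Real.log_nonneg (le_add_of_nonneg_right this)
  have hb0 : 0 ≤ biasCoeff p := by
    have := hp.alpha_pos
    unfold biasCoeff
    positivity
  have hround : ∀ k ∈ Finset.Icc 1 K, inner ℝ (aStar k) (θ k) - inner ℝ (a k) (θ k) ≤
      2 * biasCoeff p * winVar p θ k + 2 * (1 + β * p.gamma ^ 2) * t k +
      2 * √2 * β * (√(σ k ^ 2 + p.alpha ^ 2) * √(t k)) +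
      2 * min 1 (p.A * p.B) * (if k ∈ bad then 1 else 0) := by
    intro k hk
    have hk' := Finset.mem_Icc.1 hk
    have h1 := min_width_le (reg_state (p := p) (a := a) (r := reward θ a ε) (σ := σ) hp k) hp
      (a k) (σ := σ k) hβ0
    have h2 := mul_nonneg hb0 (winVar_nonneg (p := p) (θ := θ) k)
    by_cases hbad : k ∈ bad
    · have h3 := h.roundRegret_le hk'
      have h4 : 0 ≤ 2 * (1 + β * p.gamma ^ 2) * t k := mul_nonneg (by positivity) (ht0 k)
      have h5 : 0 ≤ 2 * √2 * β * (√(σ k ^ 2 + p.alpha ^ 2) * √(t k)) := by positivity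
      rw [if_pos hbad]
      linarith
    · have h3 := h.roundRegret_le_of_good hp hk' (hgood k hk' hbad)
      rw [if_neg hbad]
      linarith
  have hT : ∑ k ∈ Finset.Icc 1 K, t k ≤ (((K / p.w : ℕ) : ℝ) + 1) * (d * iota p d) :=
    sum_log_pot_le hp hd K fun i h1 h2 => h.arm_le i ⟨h1, h2⟩
  have hW : ∑ k ∈ Finset.Icc 1 K, winVar p θ k ≤ p.w * BK :=
    (sum_winVar_le hp hK).trans (by gcongr)
  have hCS : ∑ k ∈ Finset.Icc 1 K, √(σ k ^ 2 + p.alpha ^ 2) * √(t k) ≤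
      √(VK + K * p.alpha ^ 2) * √((((K / p.w : ℕ) : ℝ) + 1) * (d * iota p d)) := by
    refine (Real.sum_sqrt_mul_sqrt_le _ (fun k => by positivity) ht0).trans ?_
    gcongr
    rw [Finset.sum_add_distrib]
    simpa using hVK
  have hcard : ∑ k ∈ Finset.Icc 1 K, (if k ∈ bad then (1 : ℝ) else 0) ≤ bad.card := by
    rw [← Finset.sum_filter, Finset.sum_const, nsmul_eq_mul, mul_one]
    exact_mod_cast Finset.card_le_card fun k hk => (Finset.mem_filter.1 hk).2
  refine (Finset.sum_le_sum hround).trans ?_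
  simp only [Finset.sum_add_distrib, ← Finset.mul_sum]
  gcongr

end IsTrajectory

/-- The bound of the explicit regret theorem. -/
noncomputable def regretBound (p : Params) (d K : ℕ) (BK VK : ℝ) : ℝ :=
  2 * p.A ^ 2 * BK * (p.w : ℝ) ^ (3 / 2 : ℝ) / p.alpha * √(d / p.lam)
    + 4 * betaMax p d * √(VK + K * p.alpha ^ 2) * √(K * d * iota p d / p.w)
    + 4 * d * iota p d * K * betaMax p d * p.gamma ^ 2 / p.w + 4 * d * iota p d * K / p.w

theorem bias_le (hp : p.Valid) (hd : 1 ≤ d) {BK : ℝ} (hBK : 0 ≤ BK) :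
    2 * biasCoeff p * (p.w * BK) ≤
      2 * p.A ^ 2 * BK * (p.w : ℝ) ^ (3 / 2 : ℝ) / p.alpha * √(d / p.lam) := by
  have hl := hp.lam_pos
  have hal := hp.alpha_pos
  have hd1 : (1 : ℝ) ≤ d := by exact_mod_cast hd
  have hw : (0 : ℝ) < p.w := by exact_mod_cast hp.one_le_w
  have e1 : (p.w : ℝ) ^ (3 / 2 : ℝ) = p.w * √p.w := by
    rw [Real.sqrt_eq_rpow, show (3 / 2 : ℝ) = 1 + 1 / 2 by norm_num, Real.rpow_add hw,
      Real.rpow_one]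
  have hsl := Real.sqrt_pos.2 hl
  have e2 : 1 / √p.lam ≤ √(d / p.lam) := by
    rw [one_div, ← Real.sqrt_inv]
    apply Real.sqrt_le_sqrt
    rw [div_eq_mul_inv]
    exact le_mul_of_one_le_left (by positivity) hd1
  calc 2 * biasCoeff p * (p.w * BK)
      = 2 * p.A ^ 2 * BK * (p.w * √p.w) / p.alpha * (1 / √p.lam) := by
        rw [biasCoeff]
        field_simp
    _ ≤ _ := by
        rw [e1]
        gcongr

/-- The slack that absorbs the rounds whose confidence bound fails. -/
theorem min_one_mul_le_slack (hp : p.Valid) (hd : 1 ≤ d) {K : ℕ} :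
    min 1 (p.A * p.B) * (K / (4 * p.w)) ≤
      d * iota p d * (K / p.w) + betaMax p d * p.alpha * K * √(d * iota p d / p.w) / 2 := by
  have hl := hp.lam_pos
  have hal := hp.alpha_pos
  have hA := hp.A_nonneg
  have hB := hp.B_nonneg
  have hd1 : (1 : ℝ) ≤ d := by exact_mod_cast hd
  have hw : (1 : ℝ) ≤ p.w := by exact_mod_cast hp.one_le_w
  have hβ := sqrt_lam_mul_le_betaMax (d := d) hp
  have hβ0 : 0 ≤ betaMax p d := (mul_nonneg (Real.sqrt_nonneg _) hB).trans hβ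
  set y := p.A ^ 2 / (p.lam * p.alpha ^ 2) with hy
  have hy0 : 0 ≤ y := by positivity
  have hι : p.w * y / (1 + p.w * y) ≤ d * iota p d := by
    have h1 := div_one_add_le_log (u := p.w * y / d) (by positivity)
    have h2 : p.w * y / d = p.w * p.A ^ 2 / (d * p.lam * p.alpha ^ 2) := by
      rw [hy]
      field_simp
    rw [iota, ← h2]
    calc p.w * y / (1 + p.w * y) ≤ p.w * y / (1 + p.w * y / d) := by
          gcongr
          exact div_le_self (by positivity) hd1
      _ = d * (p.w * y / d / (1 + p.w * y / d)) := by field_simp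
      _ ≤ _ := by gcongr
  have hdi : 0 ≤ d * iota p d := mul_nonneg (by positivity) (iota_nonneg hp)
  have hKw : (K : ℝ) / (4 * p.w) = K / p.w / 4 := by field_simp
  have hKw0 : (0 : ℝ) ≤ K / p.w := by positivity
  rw [hKw]
  rcases le_total 1 (p.w * y) with h | h
  · have h1 : 1 / 2 ≤ d * iota p d := by
      refine le_trans ?_ hι
      rw [div_le_div_iff₀ (by positivity) (by positivity)]
      linarith
    have h2 : min 1 (p.A * p.B) * (K / p.w / 4) ≤ 1 * (K / p.w / 4) := by
      gcongr
      exact min_le_left _ _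
    have h3 : 0 ≤ betaMax p d * p.alpha * K * √(d * iota p d / p.w) / 2 := by positivity
    nlinarith
  · have h1 : y / 2 ≤ d * iota p d / p.w := by
      rw [le_div_iff₀ (by positivity)]
      refine le_trans ?_ hι
      rw [le_div_iff₀ (by positivity)]
      nlinarith [mul_nonneg (by linarith : (0 : ℝ) ≤ p.w) hy0]
    have h2 : √y / 2 ≤ √(d * iota p d / p.w) := by
      apply Real.le_sqrt_of_sq_le
      rw [div_pow, Real.sq_sqrt hy0]
      linarith
    have h3 : p.A * p.B ≤ betaMax p d * p.alpha * √y := by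
      have h4 : √y = p.A / (√p.lam * p.alpha) := by
        rw [hy, Real.sqrt_div (sq_nonneg _), Real.sqrt_mul hl.le, Real.sqrt_sq hA,
          Real.sqrt_sq hal.le]
      have hsl := Real.sqrt_pos.2 hl
      rw [h4]
      calc p.A * p.B = (√p.lam * p.B) * p.alpha * (p.A / (√p.lam * p.alpha)) := by field_simp
        _ ≤ _ := by gcongr
    calc min 1 (p.A * p.B) * (K / p.w / 4) ≤ betaMax p d * p.alpha * √y * (K / 4) := by
          gcongr
          · exact (min_le_right _ _).trans h3
          · exact div_le_self (by positivity) hw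
      _ = betaMax p d * p.alpha * K * (√y / 2) / 2 := by ring
      _ ≤ betaMax p d * p.alpha * K * √(d * iota p d / p.w) / 2 := by gcongr
      _ ≤ _ := le_add_of_nonneg_left (by positivity)

theorem IsTrajectory.regret_le_regretBound {K : ℕ} {θ a aStar : ℕ → Vec d} {ε σ : ℕ → ℝ}
    (h : IsTrajectory p K θ a aStar ε σ) (hp : p.Valid) (hd : 1 ≤ d) (hK : p.w ≤ K)
    {BK VK : ℝ} (hBK : ∑ k ∈ Finset.Ico 1 K, ‖θ (k + 1) - θ k‖ ≤ BK)
    (hVK : ∑ k ∈ Finset.Icc 1 K, σ k ^ 2 ≤ VK) {bad : Finset ℕ}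
    (hgood : ∀ k ∈ Set.Icc 1 K, k ∉ bad →
      √(noiseSq p a ε σ k) + √p.lam * p.B ≤ betaHat p d k)
    (hbad : (bad.card : ℝ) < if K < 2 * p.w then 1 else (K : ℝ) / (8 * p.w)) :
    regret K θ aStar a ≤ regretBound p d K BK VK := by
  have hw : (1 : ℝ) ≤ p.w := by exact_mod_cast hp.one_le_w
  have hKr : (p.w : ℝ) ≤ K := by exact_mod_cast hK
  have h1 := h.regret_le hp hd (hp.one_le_w.trans hK) hBK hVK hgood
  have h2 := bias_le hp hd (BK := BK) ((Finset.sum_nonneg fun _ _ => norm_nonneg _).trans hBK)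
  have hβ0 : 0 ≤ betaMax p d := (mul_nonneg (Real.sqrt_nonneg _) hp.B_nonneg).trans
    (sqrt_lam_mul_le_betaMax hp)
  have hdi : 0 ≤ d * iota p d := mul_nonneg (by positivity) (iota_nonneg hp)
  have hVK0 : 0 ≤ VK := (Finset.sum_nonneg fun _ _ => sq_nonneg _).trans hVK
  have hAB : 0 ≤ min 1 (p.A * p.B) := le_min zero_le_one (mul_nonneg hp.A_nonneg hp.B_nonneg)
  have hal := hp.alpha_pos
  have hS0 : 0 ≤ √(VK + K * p.alpha ^ 2) := Real.sqrt_nonneg _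
  set N : ℝ := ((K / p.w : ℕ) : ℝ) + 1 with hN
  set β := betaMax p d with hβ
  set ι := d * iota p d with hι
  set S := √(VK + K * p.alpha ^ 2) with hS
  set Q := √(ι * (K / p.w)) with hQ
  have hKw0 : (0 : ℝ) ≤ K / p.w := by positivity
  have hg0 : 0 ≤ β * p.gamma ^ 2 := by positivity
  have hbound : regretBound p d K BK VK =
      2 * p.A ^ 2 * BK * (p.w : ℝ) ^ (3 / 2 : ℝ) / p.alpha * √(d / p.lam) +
      4 * β * (S * Q) + 4 * (1 + β * p.gamma ^ 2) * (ι * (K / p.w)) := by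
    rw [regretBound, hQ, show ι * (K / p.w) = K * d * iota p d / p.w by rw [hι]; ring]
    ring
  rw [hbound]
  have hdivle : ((K / p.w : ℕ) : ℝ) ≤ K / p.w := Nat.cast_div_le
  by_cases hcase : K < 2 * p.w
  · rw [if_pos hcase] at hbad
    have hcard : bad.card = 0 := by
      have : bad.card < 1 := by exact_mod_cast hbad
      omega
    have hNle : N ≤ 2 * (K / p.w) := by
      have : 1 ≤ (K : ℝ) / p.w := by rwa [one_le_div (by positivity)]
      linarith
    have h3 : √(N * ι) ≤ √2 * Q := by
      rw [hQ, ← Real.sqrt_mul zero_le_two]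
      apply Real.sqrt_le_sqrt
      linarith [mul_le_mul_of_nonneg_right hNle hdi]
    have h4 : N * ι ≤ 2 * (ι * (K / p.w)) := by
      linarith [mul_le_mul_of_nonneg_right hNle hdi]
    rw [hcard, Nat.cast_zero, mul_zero, add_zero] at h1
    have h5 : 2 * √2 * β * (S * √(N * ι)) ≤ 4 * β * (S * Q) := by
      calc 2 * √2 * β * (S * √(N * ι)) ≤ 2 * √2 * β * (S * (√2 * Q)) := by gcongr
        _ = 2 * (√2 * √2) * β * (S * Q) := by ring
        _ = _ := by rw [Real.mul_self_sqrt zero_le_two]; ring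
    have h6 : 2 * (1 + β * p.gamma ^ 2) * (N * ι) ≤
        2 * (1 + β * p.gamma ^ 2) * (2 * (ι * (K / p.w))) := by gcongr
    linarith
  · rw [if_neg hcase] at hbad
    push Not at hcase
    have hcaseR : 2 * (p.w : ℝ) ≤ K := by exact_mod_cast hcase
    have hNle : N ≤ 3 / 2 * (K / p.w) := by
      have : 2 ≤ (K : ℝ) / p.w := by rwa [le_div_iff₀ (by positivity)]
      linarith
    have h3 : 2 * √2 * √(N * ι) ≤ 7 / 2 * Q := by
      have h31 : 2 * √2 * √(N * ι) = √(2 ^ 2 * (2 * (N * ι))) := by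
        rw [Real.sqrt_mul (sq_nonneg 2), Real.sqrt_sq zero_le_two, Real.sqrt_mul zero_le_two]
        ring
      have h32 : 7 / 2 * Q = √((7 / 2) ^ 2 * (ι * (K / p.w))) := by
        rw [Real.sqrt_mul (sq_nonneg _), Real.sqrt_sq (by positivity)]
      rw [h31, h32]
      apply Real.sqrt_le_sqrt
      have := mul_le_mul_of_nonneg_right hNle hdi
      nlinarith [mul_nonneg hdi hKw0]
    have h4 : N * ι ≤ 3 / 2 * (ι * (K / p.w)) := by
      linarith [mul_le_mul_of_nonneg_right hNle hdi]
    have h5 : 2 * √2 * β * (S * √(N * ι)) ≤ 7 / 2 * (β * (S * Q)) := by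
      calc 2 * √2 * β * (S * √(N * ι)) = β * S * (2 * √2 * √(N * ι)) := by ring
        _ ≤ β * S * (7 / 2 * Q) := by gcongr
        _ = _ := by ring
    have h6 : 2 * (1 + β * p.gamma ^ 2) * (N * ι) ≤
        2 * (1 + β * p.gamma ^ 2) * (3 / 2 * (ι * (K / p.w))) := by gcongr
    have h7 : 2 * min 1 (p.A * p.B) * bad.card ≤ min 1 (p.A * p.B) * (K / (4 * p.w)) := by
      calc 2 * min 1 (p.A * p.B) * bad.card
          ≤ 2 * min 1 (p.A * p.B) * (K / (8 * p.w)) := by gcongr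
        _ = _ := by field_simp; ring
    have h8 := min_one_mul_le_slack hp hd (K := K)
    have h9 : β * p.alpha * K * √(ι / p.w) ≤ β * (S * Q) := by
      have h91 : p.alpha * K * √(ι / p.w) ≤ S * Q := by
        rw [hS, hQ, ← Real.sqrt_mul (by positivity)]
        apply Real.le_sqrt_of_sq_le
        rw [mul_pow, Real.sq_sqrt (by positivity)]
        calc (p.alpha * K) ^ 2 * (ι / p.w) = (0 + K * p.alpha ^ 2) * (ι * (K / p.w)) := by ring
          _ ≤ _ := by gcongr
      calc β * p.alpha * K * √(ι / p.w) = β * (p.alpha * K * √(ι / p.w)) := by ring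
        _ ≤ _ := by gcongr
    have h10 : 0 ≤ β * p.gamma ^ 2 * (ι * (K / p.w)) := by positivity
    linarith

end RestartedOFUL

namespace RestartedOFUL

variable {p : Params} {d : ℕ}

theorem state_congr {a : ℕ → Vec d} {r σ σ' : ℕ → ℝ} {k : ℕ}
    (h : ∀ i, 1 ≤ i → i < k → σ i = σ' i) : state p a r σ k = state p a r σ' k := by
  induction k using round_induction p with
  | restart k hk => rw [state_restart hk, state_restart hk]
  | step k hk hk' ih =>
    rw [state_succ hk hk', state_succ hk hk', ih fun i h1 h2 => h i h1 (by omega),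
      h k hk (by omega)]

theorem withProb_of_ae {Ω : Type*} [MeasurableSpace Ω] {μ : Measure Ω} {q : ℝ} {S : Ω → Prop}
    {E : Set Ω} (hE : MeasurableSet E) (hq : q ≤ μ.real E) (h : ∀ᵐ ω ∂μ, ω ∈ E → S ω) :
    WithProb μ q S := by
  refine ⟨E ∩ (toMeasurable μ {ω | ¬(ω ∈ E → S ω)})ᶜ,
    hE.inter (measurableSet_toMeasurable _ _).compl, ?_, fun ω hω => ?_⟩
  · rwa [Measure.real, ← Set.sdiff_eq, measure_sdiff_null]
    rw [measure_toMeasurable]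
    exact h
  · by_contra hS
    exact hω.2 (subset_toMeasurable μ _ fun h' => hS (h' hω.1))

section

variable {Ω : Type*} [MeasurableSpace Ω] {μ : Measure Ω} {K : ℕ} {BK VK : ℝ} {θ : ℕ → Vec d}
  {D : ℕ → Ω → Set (Vec d)} {a aStar : ℕ → Ω → Vec d} {ε σ : ℕ → Ω → ℝ}

theorem IsRun.noiseModel (h : IsRun μ p K BK VK θ D a aStar ε σ) : NoiseModel μ p K a ε where
  meas_a := h.meas_a
  meas_noise := h.meas_noise
  arm_le k hk ω := h.arm_le k hk ω _ (h.play_mem k hk ω)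
  noise_bdd := h.noise_bdd
  noise_mean := h.noise_mean

theorem IsRun.isTrajectory (h : IsRun μ p K BK VK θ D a aStar ε σ) (ω : Ω) :
    IsTrajectory p K θ (fun k => a k ω) (fun k => aStar k ω) (fun k => ε k ω)
      fun k => σ k ω where
  theta_le := h.theta_le
  arm_le k hk := h.arm_le k hk ω _ (h.play_mem k hk ω)
  opt_le k hk := h.arm_le k hk ω _ (h.opt_mem k hk ω)
  mean_arm k hk := h.mean_mem k hk ω _ (h.play_mem k hk ω)
  mean_opt k hk := h.mean_mem k hk ω _ (h.opt_mem k hk ω)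
  play_max k hk := h.play_max k hk ω _ (h.opt_mem k hk ω)

theorem IsRun.sigma_eq_condSd (h : IsRun μ p K BK VK θ D a aStar ε σ) :
    ∀ᵐ ω ∂μ, ∀ k ∈ Set.Icc 1 K, σ k ω = condSd μ a ε k ω := by
  rw [ae_ball_iff (Set.to_countable _)]
  intro k hk
  filter_upwards [h.noise_var k hk] with ω hω
  rw [condSd, hω, Real.sqrt_sq (h.sigma_nonneg k hk ω)]

/-- The explicit regret bound. -/
theorem IsRun.withProb_regret_le [IsProbabilityMeasure μ]
    (h : IsRun μ p K BK VK θ D a aStar ε σ) (hd : 1 ≤ d) (hp : p.Valid) (hK : p.w ≤ K) :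
    WithProb μ (1 - p.delta) fun ω =>
      regret K θ (fun k => aStar k ω) (fun k => a k ω) ≤ regretBound p d K BK VK := by
  have hw : (1 : ℝ) ≤ p.w := by exact_mod_cast hp.one_le_w
  have hdivle : ((K / p.w : ℕ) : ℝ) ≤ K / p.w := Nat.cast_div_le
  have ht : (((K / p.w : ℕ) : ℝ) + 1) / 16 ≤ if K < 2 * p.w then 1 else (K : ℝ) / (8 * p.w) := by
    split_ifs with hc
    · have : (K : ℝ) < 2 * p.w := by exact_mod_cast hc
      have : (K : ℝ) / p.w ≤ 2 := by
        rw [div_le_iff₀ (by positivity)]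
        exact this.le
      linarith
    · push Not at hc
      have : 2 * (p.w : ℝ) ≤ K := by exact_mod_cast hc
      have : 2 ≤ (K : ℝ) / p.w := by rwa [le_div_iff₀ (by positivity)]
      have e : (K : ℝ) / (8 * p.w) = K / p.w / 8 := by field_simp
      rw [e]
      linarith
  obtain ⟨hE, hq⟩ := h.noiseModel.measure_card_badRounds hp hd ht
  refine withProb_of_ae hE hq ?_
  filter_upwards [h.sigma_eq_condSd, h.variance_le] with ω hσ hV hω
  refine (h.isTrajectory ω).regret_le_regretBound hp hd hK h.variation_le hV
    (bad := badRounds μ p K a ε ω) (fun k hk hbad => ?_) hω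
  have hst : state p (fun i => a i ω) (fun i => ε i ω) (fun i => σ i ω) k =
      noiseState μ p a ε k ω := state_congr fun i h1 h2 => hσ i ⟨h1, h2.le.trans hk.2⟩
  rw [noiseSq, hst]
  refine sqrt_noiseSq_add_le (μ := μ) (a := a) (ε := ε) (ω := ω) hp fun hb => hbad ?_
  simpa [badRounds] using ⟨hk, hb⟩

end

/-- The argument of the logarithm in the order bound for the radius. -/
noncomputable def inputSize (p : Params) : ℝ :=
  2 + p.w + p.A + 1 / p.lam + 1 / p.alpha + p.gamma + 1 / p.delta

theorem inputSize_bounds (hp : p.Valid) : 4 ≤ inputSize p ∧ (p.w : ℝ) ≤ inputSize p ∧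
    p.A ≤ inputSize p ∧ 1 / p.lam ≤ inputSize p ∧ 1 / p.alpha ≤ inputSize p ∧
    p.gamma ≤ inputSize p ∧ 1 / p.delta ≤ inputSize p := by
  have h1 : (1 : ℝ) ≤ p.w := by exact_mod_cast hp.one_le_w
  have h2 := hp.A_nonneg
  have h3 := one_div_pos.2 hp.lam_pos
  have h4 := one_div_pos.2 hp.alpha_pos
  have h5 := hp.gamma_pos
  have h6 : 1 ≤ 1 / p.delta := (one_le_div hp.delta_pos).2 hp.delta_lt_one.le
  unfold inputSize
  refine ⟨?_, ?_, ?_, ?_, ?_, ?_, ?_⟩ <;> linarith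

theorem one_le_log_of_four_le {x : ℝ} (hx : 4 ≤ x) : 1 ≤ Real.log x := by
  rw [Real.le_log_iff_exp_le (by linarith)]
  linarith [Real.exp_one_lt_d9]

theorem log_one_add_le (hp : p.Valid) (hd : 1 ≤ d) :
    Real.log (1 + p.w * p.A ^ 2 / (p.alpha ^ 2 * d * p.lam)) ≤ 7 * Real.log (inputSize p) := by
  obtain ⟨h4, hw, hA, hl, ha, -, -⟩ := inputSize_bounds hp
  have hA0 := hp.A_nonneg
  have hl0 := hp.lam_pos
  have ha0 := hp.alpha_pos
  have hd1 : (1 : ℝ) ≤ d := by exact_mod_cast hd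
  set X := inputSize p
  rw [show (7 : ℝ) * Real.log X = Real.log (X ^ 7) by rw [Real.log_pow]; norm_num]
  apply Real.log_le_log (by positivity)
  have h1 : p.w * p.A ^ 2 / (p.alpha ^ 2 * d * p.lam) ≤ X ^ 6 := by
    calc p.w * p.A ^ 2 / (p.alpha ^ 2 * d * p.lam)
        ≤ p.w * p.A ^ 2 / (p.alpha ^ 2 * 1 * p.lam) := by gcongr
      _ = p.w * p.A ^ 2 * (1 / p.alpha) ^ 2 * (1 / p.lam) := by field_simp
      _ ≤ X * X ^ 2 * X ^ 2 * X := by gcongr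
      _ = X ^ 6 := by ring
  have h2 : 1 ≤ X ^ 6 := one_le_pow₀ (by linarith)
  nlinarith

theorem confLog_le (hp : p.Valid) : confLog p p.w ≤ 10 * Real.log (inputSize p) := by
  obtain ⟨h4, hw, -, -, ha, hg, hδ⟩ := inputSize_bounds hp
  have ha0 := hp.alpha_pos
  have hg0 := hp.gamma_pos
  have hδ0 := hp.delta_pos
  have hw1 : (1 : ℝ) ≤ p.w := by exact_mod_cast hp.one_le_w
  set X := inputSize p
  have hmax := le_max_right (Real.log (p.gamma ^ 2 / p.alpha)) 0
  rw [show (10 : ℝ) * Real.log X = Real.log (X ^ 10) by rw [Real.log_pow]; norm_num]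
  apply Real.log_le_log (by positivity)
  have h1 : max (Real.log (p.gamma ^ 2 / p.alpha)) 0 ≤ X ^ 3 := by
    refine max_le ?_ (by positivity)
    calc Real.log (p.gamma ^ 2 / p.alpha) ≤ p.gamma ^ 2 / p.alpha :=
          Real.log_le_self (by positivity)
      _ = p.gamma ^ 2 * (1 / p.alpha) := by ring
      _ ≤ X ^ 2 * X := by gcongr
      _ = X ^ 3 := by ring
  have h2 : (1 : ℝ) ≤ X ^ 3 := one_le_pow₀ (by linarith)
  have h3 : max (Real.log (p.gamma ^ 2 / p.alpha)) 0 + 1 ≤ X ^ 4 := by nlinarith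
  have h5 : (32 : ℝ) ≤ X ^ 3 := by
    have := pow_le_pow_left₀ (by norm_num) h4 3
    linarith
  calc 32 * (max (Real.log (p.gamma ^ 2 / p.alpha)) 0 + 1) * (p.w : ℝ) ^ 2 / p.delta
      = 32 * (max (Real.log (p.gamma ^ 2 / p.alpha)) 0 + 1) * (p.w : ℝ) ^ 2 * (1 / p.delta) := by
        ring
    _ ≤ X ^ 3 * X ^ 4 * X ^ 2 * X := by gcongr
    _ = X ^ 10 := by ring

/-- The order of the uniform radius. -/
theorem betaMax_le (hp : p.Valid) (hd : 1 ≤ d) : betaMax p d ≤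
    300 * Real.log (inputSize p) * (√d + p.R / p.gamma ^ 2 + √p.lam * p.B) := by
  have h1 := log_one_add_le hp hd
  have h2 := confLog_le hp
  have h3 := one_le_confLog hp hp.one_le_w
  have hL := one_le_log_of_four_le (inputSize_bounds hp).1
  have h4 := windowLog_nonneg (d := d) hp p.w
  have hR : 0 ≤ p.R / p.gamma ^ 2 := div_nonneg hp.R_nonneg (sq_nonneg _)
  have hB : 0 ≤ √p.lam * p.B := mul_nonneg (Real.sqrt_nonneg _) hp.B_nonneg
  set L := Real.log (inputSize p)
  have h5 : √(d * Real.log (1 + p.w * p.A ^ 2 / (p.alpha ^ 2 * d * p.lam)) * confLog p p.w) ≤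
      9 * L * √d := by
    rw [Real.sqrt_le_left (by positivity), mul_pow, Real.sq_sqrt (by positivity)]
    calc d * Real.log (1 + p.w * p.A ^ 2 / (p.alpha ^ 2 * d * p.lam)) * confLog p p.w
        ≤ d * (7 * L) * (10 * L) := by gcongr
      _ ≤ (9 * L) ^ 2 * d := by
        have : 0 ≤ d * L ^ 2 := by positivity
        nlinarith
  rw [betaMax, radius_eq, noiseRadius]
  have h6 : 30 * confLog p p.w * (p.R / p.gamma ^ 2) ≤ 30 * (10 * L) * (p.R / p.gamma ^ 2) := by
    gcongr
  have h7 : √p.lam * p.B ≤ L * (√p.lam * p.B) := le_mul_of_one_le_left hB hL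
  have h8 : 0 ≤ L * √d := by positivity
  have h9 : 0 ≤ L * (√p.lam * p.B) := by positivity
  linarith

set_option maxHeartbeats 1000000 in
/-- The order of the regret for `γ² = R / √d`. -/
theorem exists_regretBound_le {A lam B R : ℝ} (hA : 0 ≤ A) (hlam : 0 < lam) (hB : 0 ≤ B)
    (hR : 0 < R) : ∃ C : ℝ, 0 < C ∧ ∀ (d K : ℕ) (p : Params) (BK VK : ℝ), 1 ≤ d → p.Valid →
      p.w ≤ K → p.A = A → p.lam = lam → p.B = B → p.R = R → p.gamma ^ 2 = R / √d →
      0 ≤ BK → 0 ≤ VK → regretBound p d K BK VK ≤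
        C * Real.log (2 + K + 1 / p.alpha + 1 / p.delta) ^ 2
          * (BK * (p.w : ℝ) ^ (3 / 2 : ℝ) * √d / p.alpha + d * K * p.alpha / √p.w
            + d * √(K * VK / p.w) + d * K / p.w) := by
  set Z := 1 + A + 1 / lam + √R with hZ
  have hZ1 : 1 ≤ Z := by
    have : 0 ≤ 1 / lam := by positivity
    have : 0 ≤ √R := Real.sqrt_nonneg _
    linarith
  set c0 := 1 + Real.log Z with hc0
  have hc01 : 1 ≤ c0 := by linarith [Real.log_nonneg hZ1]
  set c1 := 300 * c0 * (2 + √lam * B) with hc1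
  have hc10 : 0 < c1 := by positivity
  refine ⟨2 * A ^ 2 / √lam + 4 * c1 * (1 + 7 * c0) + (28 * c0 * c1 * R + 28 * c0),
    by positivity, ?_⟩
  rintro d K p BK VK hd hp hwK rfl rfl rfl rfl hγ hBK hVK
  have hd1 : (1 : ℝ) ≤ d := by exact_mod_cast hd
  have hsd : 1 ≤ √(d : ℝ) := Real.one_le_sqrt.2 hd1
  have hw1 : (1 : ℝ) ≤ p.w := by exact_mod_cast hp.one_le_w
  have hwK' : (p.w : ℝ) ≤ K := by exact_mod_cast hwK
  have hal := hp.alpha_pos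
  have hg := hp.gamma_pos
  have hδ : 1 ≤ 1 / p.delta := (one_le_div hp.delta_pos).2 hp.delta_lt_one.le
  have hα' : 0 < 1 / p.alpha := by positivity
  have hl' : 0 < 1 / p.lam := by positivity
  set Y := 2 + K + 1 / p.alpha + 1 / p.delta with hY
  have hY4 : 4 ≤ Y := by linarith
  set L := Real.log Y with hL
  have hL1 : 1 ≤ L := one_le_log_of_four_le hY4
  have hγR : p.gamma ≤ √p.R := by
    apply Real.le_sqrt_of_sq_le
    rw [hγ]
    exact div_le_self hR.le hsd
  have hX : Real.log (inputSize p) ≤ c0 * L := by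
    have h1 : inputSize p ≤ Y * Z := by
      have h2 : 0 ≤ (Y - 1) * (Z - 1) := mul_nonneg (by linarith) (by linarith)
      unfold inputSize
      nlinarith
    have h3 : Real.log (inputSize p) ≤ L + Real.log Z := by
      rw [hL, ← Real.log_mul (by positivity) (by positivity)]
      exact Real.log_le_log (by linarith [(inputSize_bounds hp).1]) h1
    have h4 : Real.log Z ≤ Real.log Z * L := le_mul_of_one_le_right (Real.log_nonneg hZ1) hL1
    rw [hc0]
    linarith
  have hβ : betaMax p d ≤ c1 * L * √d := by
    refine (betaMax_le hp hd).trans ?_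
    have h1 : p.R / p.gamma ^ 2 = √d := by
      rw [hγ]
      field_simp
    have h2 : √p.lam * p.B ≤ √p.lam * p.B * √d := le_mul_of_one_le_right (by positivity) hsd
    calc 300 * Real.log (inputSize p) * (√d + p.R / p.gamma ^ 2 + √p.lam * p.B)
        ≤ 300 * (c0 * L) * (√d + √d + √p.lam * p.B * √d) := by
          rw [h1]
          gcongr
      _ = _ := by rw [hc1]; ring
  have hβ0 : 0 ≤ betaMax p d := (mul_nonneg (Real.sqrt_nonneg _) hp.B_nonneg).trans
    (sqrt_lam_mul_le_betaMax hp)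
  have hι : iota p d ≤ 7 * (c0 * L) := by
    have h1 := log_one_add_le hp hd
    rw [show p.alpha ^ 2 * d * p.lam = d * p.lam * p.alpha ^ 2 by ring] at h1
    exact h1.trans (by gcongr)
  have hι0 := iota_nonneg (d := d) hp
  have hL2 : L ≤ L ^ 2 := by nlinarith
  set t1 := BK * (p.w : ℝ) ^ (3 / 2 : ℝ) * √d / p.alpha with ht1
  set t2 := d * K * p.alpha / √p.w with ht2
  set t3 := d * √(K * VK / p.w) with ht3
  set t4 : ℝ := d * K / p.w with ht4
  have h1 : 2 * p.A ^ 2 * BK * (p.w : ℝ) ^ (3 / 2 : ℝ) / p.alpha * √(d / p.lam) ≤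
      2 * p.A ^ 2 / √p.lam * L ^ 2 * t1 := by
    have e : 2 * p.A ^ 2 * BK * (p.w : ℝ) ^ (3 / 2 : ℝ) / p.alpha * √(d / p.lam) =
        2 * p.A ^ 2 / √p.lam * 1 * t1 := by
      rw [Real.sqrt_div (by positivity), ht1]
      ring
    rw [e]
    have : 1 ≤ L ^ 2 := one_le_pow₀ hL1
    gcongr
  have h2 : 4 * betaMax p d * √(VK + K * p.alpha ^ 2) * √(K * d * iota p d / p.w) ≤
      4 * c1 * (1 + 7 * c0) * L ^ 2 * (t2 + t3) := by
    have h21 : √(iota p d) ≤ (1 + 7 * c0) * L := by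
      rw [Real.sqrt_le_left (by positivity)]
      have h22 : 7 * (c0 * L) ≤ (1 + 7 * c0) * L := by linarith
      have h23 : 1 ≤ (1 + 7 * c0) * L := one_le_mul_of_one_le_of_one_le (by linarith) hL1
      refine (hι.trans h22).trans ?_
      nlinarith
    have h24 : √(VK + K * p.alpha ^ 2) * √(K / p.w) ≤ √(K * VK / p.w) + K * p.alpha / √p.w := by
      have e1 : √(K * VK / p.w) = √VK * √(K / p.w) := by
        rw [← Real.sqrt_mul hVK]
        congr 1
        ring
      have e2 : K * p.alpha / √p.w = √(K * p.alpha ^ 2) * √(K / p.w) := by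
        rw [← Real.sqrt_mul (by positivity), show (K : ℝ) * p.alpha ^ 2 * (K / p.w) =
          (K * p.alpha) ^ 2 / p.w by ring, Real.sqrt_div (by positivity),
          Real.sqrt_sq (by positivity)]
      rw [e1, e2, ← add_mul]
      gcongr
      rw [Real.sqrt_le_left (by positivity)]
      have h25 := Real.sq_sqrt hVK
      have h26 := Real.sq_sqrt (show 0 ≤ K * p.alpha ^ 2 by positivity)
      have h27 : 0 ≤ √VK * √(K * p.alpha ^ 2) := by positivity
      linarith [add_sq √VK √(K * p.alpha ^ 2)]
    have e3 : √(K * d * iota p d / p.w) = √d * √(iota p d) * √(K / p.w) := by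
      rw [← Real.sqrt_mul (by positivity), ← Real.sqrt_mul (by positivity)]
      congr 1
      ring
    calc 4 * betaMax p d * √(VK + K * p.alpha ^ 2) * √(K * d * iota p d / p.w)
        = 4 * betaMax p d * √d * √(iota p d) * (√(VK + K * p.alpha ^ 2) * √(K / p.w)) := by
          rw [e3]
          ring
      _ ≤ 4 * (c1 * L * √d) * √d * ((1 + 7 * c0) * L) *
          (√(K * VK / p.w) + K * p.alpha / √p.w) := by gcongr
      _ = 4 * c1 * (1 + 7 * c0) * L ^ 2 * ((√d * √d) *
          (√(K * VK / p.w) + K * p.alpha / √p.w)) := by ring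
      _ = _ := by
          rw [Real.mul_self_sqrt (by positivity), ht2, ht3]
          ring
  have h3 : 4 * d * iota p d * K * betaMax p d * p.gamma ^ 2 / p.w ≤
      28 * c0 * c1 * p.R * L ^ 2 * t4 := by
    have h31 : betaMax p d * p.gamma ^ 2 ≤ c1 * L * p.R := by
      calc betaMax p d * p.gamma ^ 2 ≤ c1 * L * √d * p.gamma ^ 2 := by gcongr
        _ = c1 * L * p.R := by
          rw [hγ]
          field_simp
    calc 4 * d * iota p d * K * betaMax p d * p.gamma ^ 2 / p.w
        = 4 * iota p d * (betaMax p d * p.gamma ^ 2) * t4 := by rw [ht4]; ring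
      _ ≤ 4 * (7 * (c0 * L)) * (c1 * L * p.R) * t4 := by gcongr
      _ = _ := by ring
  have h4 : 4 * d * iota p d * K / p.w ≤ 28 * c0 * L ^ 2 * t4 := by
    calc 4 * d * iota p d * K / p.w = 4 * iota p d * t4 := by rw [ht4]; ring
      _ ≤ 4 * (7 * (c0 * L)) * t4 := by gcongr
      _ = 28 * c0 * L * t4 := by ring
      _ ≤ _ := by gcongr
  have ht10 : 0 ≤ t1 := by positivity
  have ht20 : 0 ≤ t2 := by positivity
  have ht30 : 0 ≤ t3 := by positivity
  have ht40 : 0 ≤ t4 := by positivity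
  set C1 := 2 * p.A ^ 2 / √p.lam
  set C2 := 4 * c1 * (1 + 7 * c0)
  set C3 := 28 * c0 * c1 * p.R + 28 * c0 with hC3
  have hC10 : 0 ≤ C1 := by positivity
  have hC20 : 0 ≤ C2 := by positivity
  have hC30 : 0 ≤ C3 := by positivity
  rw [regretBound]
  calc _ ≤ C1 * L ^ 2 * t1 + C2 * L ^ 2 * (t2 + t3) + 28 * c0 * c1 * p.R * L ^ 2 * t4 +
        28 * c0 * L ^ 2 * t4 := by gcongr
    _ = C1 * L ^ 2 * t1 + C2 * L ^ 2 * (t2 + t3) + C3 * L ^ 2 * t4 := by rw [hC3]; ring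
    _ ≤ (C1 + C2 + C3) * L ^ 2 * t1 + (C1 + C2 + C3) * L ^ 2 * (t2 + t3) +
        (C1 + C2 + C3) * L ^ 2 * t4 := by
        gcongr <;> linarith
    _ = _ := by ring

theorem IsRun.variation_nonneg {Ω : Type*} [MeasurableSpace Ω] {μ : Measure Ω} {K : ℕ} {BK VK : ℝ}
    {θ : ℕ → Vec d} {D : ℕ → Ω → Set (Vec d)} {a aStar : ℕ → Ω → Vec d} {ε σ : ℕ → Ω → ℝ}
    (h : IsRun μ p K BK VK θ D a aStar ε σ) : 0 ≤ BK :=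
  (Finset.sum_nonneg fun _ _ => norm_nonneg _).trans h.variation_le

theorem IsRun.variance_nonneg {Ω : Type*} [MeasurableSpace Ω] {μ : Measure Ω}
    [IsProbabilityMeasure μ] {K : ℕ} {BK VK : ℝ} {θ : ℕ → Vec d} {D : ℕ → Ω → Set (Vec d)}
    {a aStar : ℕ → Ω → Vec d} {ε σ : ℕ → Ω → ℝ} (h : IsRun μ p K BK VK θ D a aStar ε σ) :
    0 ≤ VK := by
  obtain ⟨ω, hω⟩ := h.variance_le.exists
  exact (Finset.sum_nonneg fun _ _ => sq_nonneg _).trans hω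

end RestartedOFUL

theorem mainTheorem1 :
    -- the explicit regret bound
    (∀ (d K : ℕ) (p : RestartedOFUL.Params) (BK VK : ℝ) (Ω : Type*) [MeasurableSpace Ω]
        (μ : MeasureTheory.Measure Ω) [MeasureTheory.IsProbabilityMeasure μ]
        (θ : ℕ → RestartedOFUL.Vec d) (D : ℕ → Ω → Set (RestartedOFUL.Vec d))
        (a aStar : ℕ → Ω → RestartedOFUL.Vec d) (ε σ : ℕ → Ω → ℝ),
      1 ≤ d → p.Valid → p.w ≤ K →
      RestartedOFUL.IsRun μ p K BK VK θ D a aStar ε σ →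
      RestartedOFUL.WithProb μ (1 - p.delta) fun ω =>
        RestartedOFUL.regret K θ (fun k => aStar k ω) (fun k => a k ω) ≤
          2 * p.A ^ 2 * BK * (p.w : ℝ) ^ (3 / 2 : ℝ) / p.alpha * Real.sqrt (d / p.lam)
          + 4 * RestartedOFUL.betaMax p d * Real.sqrt (VK + K * p.alpha ^ 2)
              * Real.sqrt (K * d * RestartedOFUL.iota p d / p.w)
          + 4 * d * RestartedOFUL.iota p d * K * RestartedOFUL.betaMax p d * p.gamma ^ 2 / p.w
          + 4 * d * RestartedOFUL.iota p d * K / p.w) ∧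
    -- the order of the uniform radius, with an absolute constant and a polylogarithmic factor
    (∃ (C : ℝ) (m : ℕ), 0 < C ∧ ∀ (d : ℕ) (p : RestartedOFUL.Params), 1 ≤ d → p.Valid →
      RestartedOFUL.betaMax p d ≤
        C * Real.log (2 + p.w + p.A + 1 / p.lam + 1 / p.alpha + p.gamma + 1 / p.delta) ^ m
          * (Real.sqrt d + p.R / p.gamma ^ 2 + Real.sqrt p.lam * p.B)) ∧
    -- the order of the regret for `γ² = R / √d`, with `A`, `λ`, `B`, `R` treated as constants
    (∃ m : ℕ, ∀ A lam B R : ℝ, 0 ≤ A → 0 < lam → 0 ≤ B → 0 < R → ∃ C : ℝ, 0 < C ∧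
      ∀ (d K : ℕ) (p : RestartedOFUL.Params) (BK VK : ℝ) (Ω : Type*) [MeasurableSpace Ω]
        (μ : MeasureTheory.Measure Ω) [MeasureTheory.IsProbabilityMeasure μ]
        (θ : ℕ → RestartedOFUL.Vec d) (D : ℕ → Ω → Set (RestartedOFUL.Vec d))
        (a aStar : ℕ → Ω → RestartedOFUL.Vec d) (ε σ : ℕ → Ω → ℝ),
      1 ≤ d → p.Valid → p.w ≤ K →
      p.A = A → p.lam = lam → p.B = B → p.R = R → p.gamma ^ 2 = R / Real.sqrt d →
      RestartedOFUL.IsRun μ p K BK VK θ D a aStar ε σ →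
      RestartedOFUL.WithProb μ (1 - p.delta) fun ω =>
        RestartedOFUL.regret K θ (fun k => aStar k ω) (fun k => a k ω) ≤
          C * Real.log (2 + K + 1 / p.alpha + 1 / p.delta) ^ m
            * (BK * (p.w : ℝ) ^ (3 / 2 : ℝ) * Real.sqrt d / p.alpha
              + d * K * p.alpha / Real.sqrt p.w
              + d * Real.sqrt (K * VK / p.w)
              + d * K / p.w)) := by
  refine ⟨?_, ⟨300, 1, by norm_num, ?_⟩, 2, ?_⟩
  · intro d K p BK VK Ω _ μ _ θ D a aStar ε σ hd hp hK h
    exact h.withProb_regret_le hd hp hK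
  · intro d p hd hp
    rw [pow_one]
    exact RestartedOFUL.betaMax_le hp hd
  · intro A lam B R hA hlam hB hR
    obtain ⟨C, hC, hbound⟩ := RestartedOFUL.exists_regretBound_le hA hlam hB hR
    refine ⟨C, hC, ?_⟩
    intro d K p BK VK Ω _ μ _ θ D a aStar ε σ hd hp hK h1 h2 h3 h4 h5 h
    obtain ⟨E, hE, hq, hS⟩ := h.withProb_regret_le hd hp hK
    exact ⟨E, hE, hq, fun ω hω => (hS ω hω).trans
      (hbound d K p BK VK hd hp hK h1 h2 h3 h4 h5 h.variation_nonneg h.variance_nonneg)⟩
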